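/- Let $m\ge 0$. For $d\in\mathbb Z$ let $e_d(\vec x)$ be the elementary symmetric function in $\vec x=(x_1,x_2,\dots)$ ($e_0=1$, $e_d=0$ for $d<0$). For a skew shape $\lambda/\mu$ put $$\mathrm{JT}_{\lambda/\mu}(\vec x)=\bigl(e_{\lambda_i-\mu_j-i+j}(\vec x)\bigr)_{i,j=1}^{\ell(\lambda)},\qquad s_{\lambda/\mu}(\vec x)=\det \mathrm{JT}_{\lambda'/\mu'}(\vec x),$$ where $'$ denotes conjugation; in particular $\mathrm{JT}_{(1^m)}(\vec x)=(e_{1-i+j}(\vec x))_{i,j=1}^m$. A ribbon is a skew shape $\lambda/\mu$ that is connected (any two cells are joined by a path of cells in which consecutive cells share an edge) and contains no $2\times2$ block of cells; $\mathcal R_m$ denotes the set of ribbons $\lambda/\mu$ with $m$ cells such that $\{i:\lambda_i>\mu_i\}=\{1,\dots,\ell(\lambda)\}$. Let $TL_m(2)$ be the $\mathbb C$-algebra with generators $t_1,\dots,t_{m-1}$ and relations $t_i^2=2t_i$, $t_it_jt_i=t_i$ if $|i-j|=1$, and $t_it_j=t_jt_i$ if $|i-j|\ge2$; it has the basis $\mathcal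 B_m$ of Kauffman diagrams (noncrossing perfect matchings of $m$ points on the left and $m$ points on the right side of a rectangle; products are concatenations, each closed loop being replaced by a factor $2$). Let $\theta:\mathbb C[\mathfrak S_m]\to TL_m(2)$ be the algebra homomorphism with $\theta((i,i+1))=t_i-1$, where permutations are composed from left to right. For $\tau\in\mathcal B_m$ let $f_\tau(w)$ be the coefficient of $\tau$ in $\theta(w)$; the Temperley–Lieb immanant of an $m\times m$ matrix $M$ is $$\mathrm{imm}_\tau(M)=\sum_{w\in\mathfrak S_m}f_\tau(w)\,M_{1,w(1)}\cdots M_{m,w(m)}.$$ Then: 1. for every ribbon $R\in\mathcal R_m$ there is $\tau\in\mathcal B_m$ with $s_R(\vec x)=\mathrm{imm}_\tau(\mathrm{JT}_{(1^m)}(\vec x))$; 2. conversely, for every $\tau\in\mathcal B_m$ with $\mathrm{imm}_\tau(\mathrm{JT}_{(1^m)}(\vec x))\ne0$ there is $R=\lambda/\mu\in\mathcal R_m$ with $\mathrm{imm}_\tau(\mathrm{JT}_{(1^m)}(\vec x))=s_R(\vec x)$; moreover $R$ can be chosen without empty columns, i.e. with $\{j:\lambda'_j>\mu'_j\}=\{1,\dots,\ell(\lambda')\}$.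 -/

import Mathlib

namespace TLImm

section Presentation

variable {G : Type*} [Monoid G]

/-- `ascWord h k r = h k * h (k+1) * ... * h (k+r-1)`. -/
def ascWord (h : ℕ → G) (k : ℕ) : ℕ → G
  | 0 => 1
  | r + 1 => ascWord h k r * h (k + r)

theorem ascWord_succ' (h : ℕ → G) (k r : ℕ) :
    ascWord h k (r + 1) = h k * ascWord h (k + 1) r := by
  induction r with
  | zero => simp [ascWord]
  | succ r ih =>
    rw [ascWord, ih, ascWord, mul_assoc, show k + (r + 1) = k + 1 + r by omega]

theorem ascWord_comm (h : ℕ → G) (N : ℕ)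
    (hc : ∀ i j, i < N → j < N → i + 2 ≤ j → h i * h j = h j * h i)
    (i k r : ℕ) (hik : i + 2 ≤ k) (hr : k + r ≤ N) :
    h i * ascWord h k r = ascWord h k r * h i := by
  induction r with
  | zero => simp [ascWord]
  | succ r ih =>
    rw [ascWord, ← mul_assoc, ih (by omega), mul_assoc, mul_assoc,
      hc i (k + r) (by omega) (by omega) (by omega)]

theorem ascWord_shift (h : ℕ → G) (N : ℕ)
    (hb : ∀ i, i + 1 < N → h (i + 1) * h i * h (i + 1) = h i * h (i + 1) * h i)
    (hc : ∀ i j, i < N → j < N → i + 2 ≤ j → h i * h j = h j * h i)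
    (i k r : ℕ) (hik : k ≤ i) (hir : i + 1 < k + r) (hr : k + r ≤ N) :
    h (i + 1) * ascWord h k r = ascWord h k r * h i := by
  induction r generalizing k with
  | zero => omega
  | succ r ih =>
    rw [ascWord_succ']
    rcases Nat.lt_or_ge k i with hlt | hge
    · rw [← mul_assoc, ← hc k (i + 1) (by omega) (by omega) (by omega), mul_assoc,
        ih (k + 1) (by omega) (by omega) (by omega), mul_assoc]
    · obtain rfl : k = i := by omega
      obtain ⟨r, rfl⟩ : ∃ r', r = r' + 1 := ⟨r - 1, by omega⟩
      rw [ascWord_succ', mul_assoc, mul_assoc,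
        ← ascWord_comm h N hc k (k + 1 + 1) r (by omega) (by omega)]
      simp only [← mul_assoc]
      rw [hb k (by omega)]

theorem exists_normalForm (h : ℕ → G) (n : ℕ)
    (hs : ∀ i, i < n + 1 → h i * h i = 1)
    (hb : ∀ i, i + 1 < n + 1 → h (i + 1) * h i * h (i + 1) = h i * h (i + 1) * h i)
    (hc : ∀ i j, i < n + 1 → j < n + 1 → i + 2 ≤ j → h i * h j = h j * h i)
    (x : G) (hx : x ∈ Submonoid.closure (h '' {i | i < n + 1})) :
    ∃ k r, k + r = n + 1 ∧ ∃ y ∈ Submonoid.closure (h '' {i | i < n}),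
      x = ascWord h k r * y := by
  induction hx using Submonoid.closure_induction_left with
  | one => exact ⟨n + 1, 0, by omega, 1, Submonoid.one_mem _, by simp [ascWord]⟩
  | mul_left a ha b hb' ih =>
    obtain ⟨i, hi, rfl⟩ := ha
    obtain ⟨k, r, hkr, y, hy, rfl⟩ := ih
    have hi' : i < n + 1 := hi
    have hmem : ∀ j, j < n → h j * y ∈ Submonoid.closure (h '' {i | i < n}) := fun j hj =>
      Submonoid.mul_mem _ (Submonoid.subset_closure ⟨j, hj, rfl⟩) hy
    rcases Nat.lt_or_ge (i + 1) k with h1 | h1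
    · exact ⟨k, r, hkr, h i * y, hmem i (by omega), by
        rw [← mul_assoc, ascWord_comm h (n + 1) hc i k r (by omega) (by omega), mul_assoc]⟩
    rcases Nat.lt_or_ge i k with h2 | h2
    · obtain rfl : k = i + 1 := by omega
      exact ⟨i, r + 1, by omega, y, hy, by rw [ascWord_succ', mul_assoc]⟩
    rcases Nat.lt_or_ge k i with h3 | h3
    · obtain ⟨j, rfl⟩ : ∃ j, i = j + 1 := ⟨i - 1, by omega⟩
      exact ⟨k, r, hkr, h j * y, hmem j (by omega), by
        rw [← mul_assoc, ascWord_shift h (n + 1) hb hc j k r (by omega) (by omega) (by omega),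
          mul_assoc]⟩
    · obtain rfl : k = i := by omega
      obtain ⟨r, rfl⟩ : ∃ r', r = r' + 1 := ⟨r - 1, by omega⟩
      exact ⟨k + 1, r, by omega, y, hy, by
        rw [ascWord_succ', ← mul_assoc, ← mul_assoc, hs k hi', one_mul]⟩

end Presentation

/-- The simple transposition exchanging the `i`-th and `(i+1)`-st letter
(letters and transpositions are counted from `0`). -/
def simpleSwap (n : ℕ) (i : Fin (n - 1)) : Equiv.Perm (Fin n) :=
  Equiv.swap ⟨i, by omega⟩ ⟨i + 1, by omega⟩

section Lift

variable {M : Type*} [Monoid M] {n : ℕ} (g : Fin (n - 1) → M)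

/-- The pairs `(s_i, g_i)`, continued by `1`. -/
def pairGen (i : ℕ) : Equiv.Perm (Fin n) × M :=
  if hi : i < n - 1 then (simpleSwap n ⟨i, hi⟩, g ⟨i, hi⟩) else 1

theorem simpleSwap_sq (i : Fin (n - 1)) : simpleSwap n i * simpleSwap n i = 1 := by
  simp [simpleSwap]

theorem simpleSwap_braid (i j : Fin (n - 1)) (hij : (j : ℕ) = i + 1) :
    simpleSwap n j * simpleSwap n i * simpleSwap n j =
      simpleSwap n i * simpleSwap n j * simpleSwap n i := by
  ext x
  simp only [simpleSwap, Equiv.Perm.mul_apply, Equiv.swap_apply_def]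
  grind

theorem simpleSwap_comm (i j : Fin (n - 1)) (hij : (i : ℕ) + 2 ≤ j) :
    simpleSwap n i * simpleSwap n j = simpleSwap n j * simpleSwap n i := by
  ext x
  simp only [simpleSwap, Equiv.Perm.mul_apply, Equiv.swap_apply_def]
  grind

theorem simpleSwap_closure (n : ℕ) :
    Submonoid.closure (Set.range (simpleSwap n)) = ⊤ := by
  rcases n with _ | n
  · rw [eq_top_iff]; intro x _
    rw [Subsingleton.elim x 1]; exact Submonoid.one_mem _
  · rw [← Equiv.Perm.mclosure_swap_castSucc_succ n]
    rfl

theorem pairGen_sq (hsq : ∀ i, g i * g i = 1) (i : ℕ) : pairGen g i * pairGen g i = 1 := by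
  unfold pairGen
  split_ifs with hi
  · simp [hsq, simpleSwap_sq]
  · simp

theorem pairGen_braid
    (hbr : ∀ i j : Fin (n - 1), (j : ℕ) = i + 1 → g j * g i * g j = g i * g j * g i)
    (i : ℕ) (hi : i + 1 < n - 1) :
    pairGen g (i + 1) * pairGen g i * pairGen g (i + 1) =
      pairGen g i * pairGen g (i + 1) * pairGen g i := by
  have hi' : i < n - 1 := by omega
  simp only [pairGen, hi, hi', dif_pos, Prod.mk_mul_mk]
  rw [hbr ⟨i, hi'⟩ ⟨i + 1, hi⟩ rfl, simpleSwap_braid ⟨i, hi'⟩ ⟨i + 1, hi⟩ rfl]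

theorem pairGen_comm
    (hco : ∀ i j : Fin (n - 1), (i : ℕ) + 2 ≤ j → g i * g j = g j * g i)
    (i j : ℕ) (hi : i < n - 1) (hj : j < n - 1) (hij : i + 2 ≤ j) :
    pairGen g i * pairGen g j = pairGen g j * pairGen g i := by
  simp only [pairGen, hi, hj, dif_pos, Prod.mk_mul_mk]
  rw [hco ⟨i, hi⟩ ⟨j, hj⟩ hij, simpleSwap_comm ⟨i, hi⟩ ⟨j, hj⟩ hij]

theorem ascWord_pairGen_apply (k r : ℕ) (hkr : k + r < n) :
    (((ascWord (pairGen g) k r).1 ⟨k + r, hkr⟩ : Fin n) : ℕ) = k := by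
  induction r with
  | zero => simp [ascWord]
  | succ r ih =>
    have h1 : k + r < n - 1 := by omega
    rw [ascWord, Prod.fst_mul, Equiv.Perm.mul_apply]
    have : (pairGen g (k + r)).1 ⟨k + (r + 1), hkr⟩ = ⟨k + r, by omega⟩ := by
      simp only [pairGen, h1, dif_pos, simpleSwap]
      exact Equiv.swap_apply_right _ _
    rw [this, ih]

theorem closure_pairGen_fixes (N : ℕ) (_hN : N < n) (x : Equiv.Perm (Fin n) × M)
    (hx : x ∈ Submonoid.closure (pairGen g '' {i | i < N})) (p : Fin n) (hp : N < (p : ℕ)) :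
    x.1 p = p := by
  induction hx using Submonoid.closure_induction_left with
  | one => rfl
  | mul_left a ha b hb ih =>
    obtain ⟨i, hi, rfl⟩ := ha
    have hi1 : i < N := hi
    have hi2 : i < n - 1 := by omega
    rw [Prod.fst_mul, Equiv.Perm.mul_apply, ih]
    simp only [pairGen, hi2, dif_pos, simpleSwap]
    apply Equiv.swap_apply_of_ne_of_ne <;> (intro h; rw [h] at hp; simp at hp; omega)

theorem closure_pairGen_eq_one (hsq : ∀ i, g i * g i = 1)
    (hbr : ∀ i j : Fin (n - 1), (j : ℕ) = i + 1 → g j * g i * g j = g i * g j * g i)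
    (hco : ∀ i j : Fin (n - 1), (i : ℕ) + 2 ≤ j → g i * g j = g j * g i)
    (N : ℕ) (hN : N ≤ n - 1) (x : Equiv.Perm (Fin n) × M)
    (hx : x ∈ Submonoid.closure (pairGen g '' {i | i < N})) (h1 : x.1 = 1) : x = 1 := by
  induction N generalizing x with
  | zero => simpa using hx
  | succ N ih =>
    obtain ⟨k, r, hkr, y, hy, rfl⟩ := exists_normalForm (pairGen g) N
      (fun i _ => pairGen_sq g hsq i) (fun i hi => pairGen_braid g hbr i (by omega))
      (fun i j hi hj hij => pairGen_comm g hco i j (by omega) (by omega) hij) x hx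
    have hlt : k + r < n := by omega
    have h2 : (ascWord (pairGen g) k r * y).1 ⟨k + r, hlt⟩ = ⟨k + r, hlt⟩ := by
      rw [h1]; rfl
    rw [Prod.fst_mul, Equiv.Perm.mul_apply,
      closure_pairGen_fixes g N (by omega) y hy ⟨k + r, hlt⟩ (by simp; omega)] at h2
    have h3 := congrArg Fin.val h2
    rw [ascWord_pairGen_apply g k r hlt] at h3
    obtain rfl : r = 0 := by simp at h3; omega
    simp only [ascWord, one_mul] at h1 ⊢
    exact ih (by omega) y hy h1

/-- All products of the pairs `(s_i, g_i)`. -/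
def pairMonoid : Submonoid (Equiv.Perm (Fin n) × M) :=
  Submonoid.closure (pairGen g '' {i | i < n - 1})

theorem pair_mem (i : Fin (n - 1)) : (simpleSwap n i, g i) ∈ pairMonoid g :=
  Submonoid.subset_closure ⟨i, i.2, by simp [pairGen]⟩

theorem pairMonoid_bijective (hsq : ∀ i, g i * g i = 1)
    (hbr : ∀ i j : Fin (n - 1), (j : ℕ) = i + 1 → g j * g i * g j = g i * g j * g i)
    (hco : ∀ i j : Fin (n - 1), (i : ℕ) + 2 ≤ j → g i * g j = g j * g i) :
    Function.Bijective ((MonoidHom.fst (Equiv.Perm (Fin n)) M).comp (pairMonoid g).subtype) := by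
  constructor
  · have hinv : ∀ x ∈ pairMonoid g, ∃ y ∈ pairMonoid g, y * x = 1 ∧ x * y = 1 := by
      intro x hx
      induction hx using Submonoid.closure_induction_left with
      | one => exact ⟨1, Submonoid.one_mem _, by simp⟩
      | mul_left a ha b hb ih =>
        obtain ⟨y, hy, h1, h2⟩ := ih
        have ha' : a ∈ pairMonoid g := Submonoid.subset_closure ha
        obtain ⟨i, hi, rfl⟩ := ha
        refine ⟨y * pairGen g i, Submonoid.mul_mem _ hy ha', ?_, ?_⟩
        · rw [mul_assoc, ← mul_assoc (pairGen g i), pairGen_sq g hsq, one_mul, h1]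
        · rw [mul_assoc, ← mul_assoc b, h2, one_mul, pairGen_sq g hsq]
    rintro ⟨x, hx⟩ ⟨y, hy⟩ hxy
    have hxy' : x.1 = y.1 := hxy
    obtain ⟨z, hz, h1, h2⟩ := hinv x hx
    have h3 : z * y = 1 := closure_pairGen_eq_one g hsq hbr hco (n - 1) le_rfl _
      (Submonoid.mul_mem _ hz hy) (by rw [Prod.fst_mul, ← hxy', ← Prod.fst_mul, h1]; rfl)
    apply Subtype.ext
    change x = y
    rw [← mul_one x, ← h3, ← mul_assoc, h2, one_mul]
  · intro w
    have hw : w ∈ Submonoid.closure (Set.range (simpleSwap n)) := by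
      rw [simpleSwap_closure]; exact Submonoid.mem_top w
    induction hw using Submonoid.closure_induction_left with
    | one => exact ⟨1, map_one _⟩
    | mul_left a ha b hb ih =>
      obtain ⟨i, rfl⟩ := ha
      obtain ⟨z, hz⟩ := ih
      refine ⟨⟨_, pair_mem g i⟩ * z, ?_⟩
      rw [map_mul, hz]
      rfl

/-- The monoid homomorphism from the symmetric group that sends each simple transposition `s_i`
to `g i`, for elements `g i` that satisfy the Coxeter relations. -/
noncomputable def permLift (hsq : ∀ i, g i * g i = 1)
    (hbr : ∀ i j : Fin (n - 1), (j : ℕ) = i + 1 → g j * g i * g j = g i * g j * g i)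
    (hco : ∀ i j : Fin (n - 1), (i : ℕ) + 2 ≤ j → g i * g j = g j * g i) :
    Equiv.Perm (Fin n) →* M :=
  ((MonoidHom.snd (Equiv.Perm (Fin n)) M).comp (pairMonoid g).subtype).comp
    (MulEquiv.ofBijective _ (pairMonoid_bijective g hsq hbr hco)).symm.toMonoidHom

theorem permLift_simpleSwap (hsq : ∀ i, g i * g i = 1)
    (hbr : ∀ i j : Fin (n - 1), (j : ℕ) = i + 1 → g j * g i * g j = g i * g j * g i)
    (hco : ∀ i j : Fin (n - 1), (i : ℕ) + 2 ≤ j → g i * g j = g j * g i) (i : Fin (n - 1)) :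
    permLift g hsq hbr hco (simpleSwap n i) = g i := by
  have h : (MulEquiv.ofBijective _ (pairMonoid_bijective g hsq hbr hco)).symm (simpleSwap n i) =
      ⟨_, pair_mem g i⟩ := by
    rw [MulEquiv.symm_apply_eq]; rfl
  change ((MulEquiv.ofBijective _ (pairMonoid_bijective g hsq hbr hco)).symm
    (simpleSwap n i)).1.2 = g i
  rw [h]

end Lift

/-- The defining relations of the Temperley-Lieb algebra with loop value `2`. -/
inductive TLRel (n : ℕ) : FreeAlgebra ℂ (Fin (n - 1)) → FreeAlgebra ℂ (Fin (n - 1)) → Prop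
  | sq (i : Fin (n - 1)) :
      TLRel n (FreeAlgebra.ι ℂ i * FreeAlgebra.ι ℂ i) ((2 : ℂ) • FreeAlgebra.ι ℂ i)
  | braid (i j : Fin (n - 1)) (hij : (i : ℕ) + 1 = j ∨ (j : ℕ) + 1 = i) :
      TLRel n (FreeAlgebra.ι ℂ i * FreeAlgebra.ι ℂ j * FreeAlgebra.ι ℂ i) (FreeAlgebra.ι ℂ i)
  | comm (i j : Fin (n - 1)) (hij : (i : ℕ) + 2 ≤ j ∨ (j : ℕ) + 2 ≤ i) :
      TLRel n (FreeAlgebra.ι ℂ i * FreeAlgebra.ι ℂ j) (FreeAlgebra.ι ℂ j * FreeAlgebra.ι ℂ i)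

/-- The Temperley-Lieb algebra `TL_n(2)` over `ℂ`, by generators and relations. -/
abbrev TL (n : ℕ) : Type := RingQuot (TLRel n)

/-- The generator `t_i` of `TL_n(2)`. -/
noncomputable def TL.t {n : ℕ} (i : Fin (n - 1)) : TL n :=
  RingQuot.mkAlgHom ℂ (TLRel n) (FreeAlgebra.ι ℂ i)

theorem TL.t_sq {n : ℕ} (i : Fin (n - 1)) : (TL.t i * TL.t i : TL n) = (2 : ℂ) • TL.t i := by
  simpa [TL.t] using RingQuot.mkAlgHom_rel ℂ (TLRel.sq i)

theorem TL.t_braid {n : ℕ} (i j : Fin (n - 1)) (hij : (i : ℕ) + 1 = j ∨ (j : ℕ) + 1 = i) :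
    (TL.t i * TL.t j * TL.t i : TL n) = TL.t i := by
  simpa [TL.t] using RingQuot.mkAlgHom_rel ℂ (TLRel.braid i j hij)

theorem TL.t_comm {n : ℕ} (i j : Fin (n - 1)) (hij : (i : ℕ) + 2 ≤ j ∨ (j : ℕ) + 2 ≤ i) :
    (TL.t i * TL.t j : TL n) = TL.t j * TL.t i := by
  simpa [TL.t] using RingQuot.mkAlgHom_rel ℂ (TLRel.comm i j hij)

theorem TL.sub_one_sq {n : ℕ} (i : Fin (n - 1)) :
    ((TL.t i - 1) * (TL.t i - 1) : TL n) = 1 := by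
  have h := TL.t_sq i
  rw [two_smul] at h
  simp only [sub_mul, mul_sub, one_mul, mul_one, h]
  abel

theorem TL.sub_one_braid {n : ℕ} (i j : Fin (n - 1)) (hij : (j : ℕ) = i + 1) :
    ((TL.t j - 1) * (TL.t i - 1) * (TL.t j - 1) : TL n) =
      (TL.t i - 1) * (TL.t j - 1) * (TL.t i - 1) := by
  have h1 := TL.t_sq i
  have h2 := TL.t_sq j
  have h3 := TL.t_braid i j (by omega)
  have h4 := TL.t_braid j i (by omega)
  rw [two_smul] at h1 h2
  simp only [sub_mul, mul_sub, one_mul, mul_one, h1, h2, h3, h4]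
  abel

theorem TL.sub_one_comm {n : ℕ} (i j : Fin (n - 1)) (hij : (i : ℕ) + 2 ≤ j) :
    ((TL.t i - 1) * (TL.t j - 1) : TL n) = (TL.t j - 1) * (TL.t i - 1) := by
  have h := TL.t_comm i j (Or.inl hij)
  simp only [sub_mul, mul_sub, one_mul, mul_one, h]
  abel

/-- The symmetric group on `n` letters in which permutations are composed from left to right. -/
abbrev SymGrp (n : ℕ) : Type := (Equiv.Perm (Fin n))ᵐᵒᵖ

/-- The algebra homomorphism `θ : ℂ[S_n] → TL_n(2)` with `θ(s_i) = t_i - 1`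
(permutations are composed from left to right; `s_i` is its own inverse, so that reversing the
order of composition amounts to inverting the permutation). -/
noncomputable def theta (n : ℕ) : MonoidAlgebra ℂ (SymGrp n) →ₐ[ℂ] TL n :=
  MonoidAlgebra.lift ℂ (TL n) (SymGrp n)
    ((permLift (fun i : Fin (n - 1) => (TL.t i - 1 : TL n)) TL.sub_one_sq TL.sub_one_braid
      TL.sub_one_comm).comp (MulEquiv.inv' (Equiv.Perm (Fin n))).symm.toMonoidHom)

theorem theta_simpleSwap (n : ℕ) (i : Fin (n - 1)) :
    theta n (MonoidAlgebra.single (MulOpposite.op (simpleSwap n i)) 1) = TL.t i - 1 := by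
  have h : (simpleSwap n i)⁻¹ = simpleSwap n i := by simp [simpleSwap]
  simp [theta, h, permLift_simpleSwap]

/-- A Kauffman diagram on `2n` boundary points, i.e. a nonintersecting perfect matching of the
points `A_1, …, A_n` (left side) and `B_1, …, B_n` (right side) of a rectangle. The points are
numbered along the boundary of the rectangle: `A_i` has the number `i - 1` and `B_i` has the number
`2n - i`. `partner` sends a point to the other end of its edge; two edges `{x, partner x}` and
`{y, partner y}` inside the rectangle can be drawn without intersection iff their ends do not
alternate along the boundary. -/
@[ext]
structure KauffmanDiagram (n : ℕ) where
  partner : Equiv.Perm (Fin (2 * n))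
  partner_partner : ∀ x, partner (partner x) = x
  partner_ne : ∀ x, partner x ≠ x
  noncrossing : ∀ x y, x < y → y < partner x → ¬ partner x < partner y

namespace KauffmanDiagram

variable {n : ℕ}

/-- The diagram of the identity: `A_i` is joined to `B_i` for all `i`. -/
def one (n : ℕ) : KauffmanDiagram n where
  partner := Fin.revPerm
  partner_partner x := by simp
  partner_ne x := by
    intro h
    have := congrArg Fin.val h
    simp [Fin.val_rev] at this
    omega
  noncrossing x y hxy _ h := by
    simp at h
    exact absurd hxy (not_lt.mpr h.le)

/-- The left boundary point `A_{i+1}` (`i` counted from `0`). -/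
def ptA (i : Fin (n - 1)) : Fin (2 * n) := ⟨i, by omega⟩

/-- The left boundary point `A_{i+2}` (`i` counted from `0`). -/
def ptA' (i : Fin (n - 1)) : Fin (2 * n) := ⟨i + 1, by omega⟩

/-- The partner map after joining the diagram of `t_i` to the left side of `d`. -/
def cupPerm (i : Fin (n - 1)) (d : KauffmanDiagram n) : Equiv.Perm (Fin (2 * n)) :=
  Equiv.swap (ptA' i) (d.partner (ptA i)) * d.partner * Equiv.swap (ptA' i) (d.partner (ptA i))

theorem cupPerm_apply (i : Fin (n - 1)) (d : KauffmanDiagram n) (x : Fin (2 * n)) :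
    cupPerm i d x = if x = ptA i then ptA' i else if x = ptA' i then ptA i
      else if x = d.partner (ptA i) then d.partner (ptA' i)
      else if x = d.partner (ptA' i) then d.partner (ptA i) else d.partner x := by
  have h1 := d.partner_partner
  have h2 := d.partner_ne
  have h3 : ptA i ≠ ptA' i := by simp [ptA, ptA', Fin.ext_iff]
  simp only [cupPerm, Equiv.Perm.mul_apply, Equiv.swap_apply_def]
  grind

/-- The diagram obtained by joining the diagram of `t_i` to the left side of `d` and removing
the loop, if there is one: `A_i` and `A_{i+1}` become partners, and so do the former partners of
`A_i` and `A_{i+1}`, unless these two points were partners already. -/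
def cup (i : Fin (n - 1)) (d : KauffmanDiagram n) : KauffmanDiagram n where
  partner := cupPerm i d
  partner_partner x := by
    simp [cupPerm, d.partner_partner]
  partner_ne x h := by
    apply d.partner_ne (Equiv.swap (ptA' i) (d.partner (ptA i)) x)
    apply (Equiv.swap (ptA' i) (d.partner (ptA i))).injective
    simpa [cupPerm] using h
  noncrossing x y h1 h2 h3 := by
    have k1 := d.partner_partner
    have k2 := d.partner_ne
    have k3 := d.noncrossing
    have hA : (ptA' i : ℕ) = (ptA i : ℕ) + 1 := rfl
    have e1 := k1 x
    have e2 := k1 y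
    have e3 := k1 (ptA i)
    have e4 := k1 (ptA' i)
    rw [cupPerm_apply] at h2 h3
    rw [cupPerm_apply] at h3
    simp only [Fin.lt_def] at k3 h1 h2 h3
    have q1 := k3 (ptA i) x
    have q2 := k3 x (ptA i)
    have q3 := k3 (ptA i) y
    have q4 := k3 y (ptA i)
    have q5 := k3 (ptA' i) x
    have q6 := k3 x (ptA' i)
    have q7 := k3 (ptA' i) y
    have q8 := k3 y (ptA' i)
    have q9 := k3 x y
    have q10 := k3 (ptA i) (ptA' i)
    split_ifs at h2 h3 <;> simp only [Fin.ext_iff] at * <;> grind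

theorem cup_apply (i : Fin (n - 1)) (d : KauffmanDiagram n) (x : Fin (2 * n)) :
    (cup i d).partner x = if x = ptA i then ptA' i else if x = ptA' i then ptA i
      else if x = d.partner (ptA i) then d.partner (ptA' i)
      else if x = d.partner (ptA' i) then d.partner (ptA i) else d.partner x :=
  cupPerm_apply i d x

/-- The scalar that arises when the diagram of `t_i` is joined to the left side of `d`: it is `2`
if a loop is formed and removed, and `1` otherwise. -/
def loopFactor (i : Fin (n - 1)) (d : KauffmanDiagram n) : ℂ :=
  if d.partner (ptA i) = ptA' i then 2 else 1

theorem cup_cup_self (i : Fin (n - 1)) (d : KauffmanDiagram n) : cup i (cup i d) = cup i d := by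
  have h1 := d.partner_partner
  have h2 := d.partner_ne
  have h3 : ptA i ≠ ptA' i := by simp [ptA, ptA', Fin.ext_iff]
  ext x
  congr 1
  simp only [cup_apply]
  grind

theorem loopFactor_cup_self (i : Fin (n - 1)) (d : KauffmanDiagram n) :
    loopFactor i (cup i d) = 2 := by
  simp [loopFactor, cup_apply]

theorem ptA'_eq_ptA (i j : Fin (n - 1)) (hij : (i : ℕ) + 1 = j) : (ptA' i : Fin (2 * n)) = ptA j := by
  simp [ptA, ptA', hij]

theorem ptA_inj (i j : Fin (n - 1)) (h : (ptA i : Fin (2 * n)) = ptA j) : i = j := by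
  simpa [ptA, Fin.ext_iff] using h

theorem cup_cup_cup (i j : Fin (n - 1)) (hij : (i : ℕ) + 1 = j ∨ (j : ℕ) + 1 = i)
    (d : KauffmanDiagram n) : cup i (cup j (cup i d)) = cup i d := by
  have h1 := d.partner_partner
  have h2 := d.partner_ne
  have h3 : ptA i ≠ ptA' i := by simp [ptA, ptA', Fin.ext_iff]
  have h4 : ptA j ≠ ptA' j := by simp [ptA, ptA', Fin.ext_iff]
  ext x
  congr 1
  rcases hij with hij | hij
  · have h5 := ptA'_eq_ptA i j hij
    have h6 : ptA i ≠ ptA' j := by simp only [ptA, ptA', ne_eq, Fin.ext_iff]; omega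
    simp only [cup_apply]
    grind
  · have h5 := ptA'_eq_ptA j i hij
    have h6 : ptA j ≠ ptA' i := by simp only [ptA, ptA', ne_eq, Fin.ext_iff]; omega
    simp only [cup_apply]
    grind

theorem loopFactor_cup_cup (i j : Fin (n - 1)) (hij : (i : ℕ) + 1 = j ∨ (j : ℕ) + 1 = i)
    (d : KauffmanDiagram n) : loopFactor j (cup i d) = 1 := by
  unfold loopFactor
  rw [if_neg]
  have h3 : ptA i ≠ ptA' i := by simp [ptA, ptA', Fin.ext_iff]
  have h4 : ptA j ≠ ptA' j := by simp [ptA, ptA', Fin.ext_iff]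
  have h1 := d.partner_partner
  have h2 := d.partner_ne
  rcases hij with hij | hij
  · have h5 := ptA'_eq_ptA i j hij
    have h6 : ptA i ≠ ptA' j := by simp only [ptA, ptA', ne_eq, Fin.ext_iff]; omega
    simp only [cup_apply]
    grind
  · have h5 := ptA'_eq_ptA j i hij
    have h6 : ptA j ≠ ptA' i := by simp only [ptA, ptA', ne_eq, Fin.ext_iff]; omega
    simp only [cup_apply]
    grind

theorem loopFactor_cup_cup_cup (i j : Fin (n - 1)) (hij : (i : ℕ) + 1 = j ∨ (j : ℕ) + 1 = i)
    (d : KauffmanDiagram n) : loopFactor i (cup j (cup i d)) = 1 :=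
  loopFactor_cup_cup j i hij.symm (cup i d)

theorem cup_comm (i j : Fin (n - 1)) (hij : (i : ℕ) + 2 ≤ j) (d : KauffmanDiagram n) :
    cup i (cup j d) = cup j (cup i d) := by
  have h1 := d.partner_partner
  have h2 := d.partner_ne
  have h3 : ptA i ≠ ptA' i := by simp [ptA, ptA', Fin.ext_iff]
  have h4 : ptA j ≠ ptA' j := by simp [ptA, ptA', Fin.ext_iff]
  have h5 : ptA i ≠ ptA' j := by simp only [ptA, ptA', ne_eq, Fin.ext_iff]; omega
  have h6 : ptA j ≠ ptA' i := by simp only [ptA, ptA', ne_eq, Fin.ext_iff]; omega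
  have h7 : ptA j ≠ ptA i := by simp only [ptA, ne_eq, Fin.ext_iff]; omega
  have h8 : ptA' j ≠ ptA' i := by simp only [ptA', ne_eq, Fin.ext_iff]; omega
  ext x
  congr 1
  simp only [cup_apply]
  grind (splits := 25)

theorem loopFactor_comm (i j : Fin (n - 1)) (hij : (i : ℕ) + 2 ≤ j) (d : KauffmanDiagram n) :
    loopFactor j d * loopFactor i (cup j d) = loopFactor i d * loopFactor j (cup i d) := by
  have h1 := d.partner_partner
  have h2 := d.partner_ne
  have h3 : ptA i ≠ ptA' i := by simp [ptA, ptA', Fin.ext_iff]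
  have h4 : ptA j ≠ ptA' j := by simp [ptA, ptA', Fin.ext_iff]
  have h5 : ptA i ≠ ptA' j := by simp only [ptA, ptA', ne_eq, Fin.ext_iff]; omega
  have h6 : ptA j ≠ ptA' i := by simp only [ptA, ptA', ne_eq, Fin.ext_iff]; omega
  have h7 : ptA j ≠ ptA i := by simp only [ptA, ne_eq, Fin.ext_iff]; omega
  have h8 : ptA' j ≠ ptA' i := by simp only [ptA', ne_eq, Fin.ext_iff]; omega
  unfold loopFactor
  simp only [cup_apply]
  grind

/-- Concatenation with the diagram of `t_i` on the left, extended linearly to the space with the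
basis of all Kauffman diagrams. -/
noncomputable def genAct (i : Fin (n - 1)) : Module.End ℂ (KauffmanDiagram n →₀ ℂ) :=
  Finsupp.linearCombination ℂ fun d => Finsupp.single (cup i d) (loopFactor i d)

theorem genAct_single (i : Fin (n - 1)) (d : KauffmanDiagram n) (c : ℂ) :
    genAct i (Finsupp.single d c) = Finsupp.single (cup i d) (c * loopFactor i d) := by
  simp [genAct]

theorem genAct_rel (x y : FreeAlgebra ℂ (Fin (n - 1))) (h : TLRel n x y) :
    FreeAlgebra.lift ℂ (genAct (n := n)) x = FreeAlgebra.lift ℂ (genAct (n := n)) y := by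
  have hcomm : ∀ i j : Fin (n - 1), (i : ℕ) + 2 ≤ j →
      (genAct i * genAct j : Module.End ℂ (KauffmanDiagram n →₀ ℂ)) = genAct j * genAct i := by
    intro i j hij
    refine Finsupp.lhom_ext fun d c => ?_
    simp only [Module.End.mul_apply, genAct_single, cup_comm i j hij, mul_assoc,
      loopFactor_comm i j hij]
  cases h with
  | sq i =>
    simp only [map_mul, map_smul, FreeAlgebra.lift_ι_apply]
    refine Finsupp.lhom_ext fun d c => ?_
    simp only [Module.End.mul_apply, genAct_single, cup_cup_self, loopFactor_cup_self,
      LinearMap.smul_apply, Finsupp.smul_single, smul_eq_mul, mul_comm]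
  | braid i j hij =>
    simp only [map_mul, FreeAlgebra.lift_ι_apply]
    refine Finsupp.lhom_ext fun d c => ?_
    simp only [Module.End.mul_apply, genAct_single, cup_cup_cup i j hij, loopFactor_cup_cup i j hij,
      loopFactor_cup_cup_cup i j hij, mul_one]
  | comm i j hij =>
    simp only [map_mul, FreeAlgebra.lift_ι_apply]
    rcases hij with hij | hij
    · exact hcomm i j hij
    · exact (hcomm j i hij).symm

end KauffmanDiagram

/-- The action of `TL_n(2)` by concatenation of diagrams from the left. -/
noncomputable def diagramAction (n : ℕ) :
    TL n →ₐ[ℂ] Module.End ℂ (KauffmanDiagram n →₀ ℂ) :=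
  RingQuot.liftAlgHom ℂ ⟨FreeAlgebra.lift ℂ KauffmanDiagram.genAct,
    fun {x y} h => KauffmanDiagram.genAct_rel x y h⟩

theorem diagramAction_t {n : ℕ} (i : Fin (n - 1)) :
    diagramAction n (TL.t i) = KauffmanDiagram.genAct i := by
  simp [diagramAction, TL.t]

/-- The expansion of an element of `TL_n(2)` in the basis of Kauffman diagrams: a product of
generators `t_{i_1} ⋯ t_{i_k}` is sent to the concatenation of their diagrams, in which each removed
loop has been replaced by a factor `2`. -/
noncomputable def diagramExpansion {n : ℕ} (x : TL n) : KauffmanDiagram n →₀ ℂ :=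
  diagramAction n x (Finsupp.single (KauffmanDiagram.one n) 1)

/-- `f_τ(w)`: the coefficient of `τ` in `θ(w)`. -/
noncomputable def tlFun {n : ℕ} (τ : KauffmanDiagram n) (w : Equiv.Perm (Fin n)) : ℂ :=
  diagramExpansion (theta n (MonoidAlgebra.single (MulOpposite.op w) 1)) τ

/-- The `f`-immanant of a square matrix. -/
def immanant {n : ℕ} {A : Type*} [CommRing A] [Algebra ℂ A] (f : Equiv.Perm (Fin n) → ℂ)
    (M : Matrix (Fin n) (Fin n) A) : A :=
  ∑ w : Equiv.Perm (Fin n), f w • ∏ i, M i (w i)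

/-- The Temperley-Lieb immanant for the Kauffman diagram `τ`. -/
noncomputable def tlImmanant {n : ℕ} {A : Type*} [CommRing A] [Algebra ℂ A]
    (τ : KauffmanDiagram n) (M : Matrix (Fin n) (Fin n) A) : A :=
  immanant (tlFun τ) M

open Classical in
/-- The elementary symmetric function `e_d` in the variables `x_0, x_1, …`, as a formal power
series: the sum of all monomials of degree `d` in which every exponent is at most `1`
(so that `e_0 = 1`, and `e_d = 0` for `d < 0`). -/
noncomputable def elemSymm (d : ℤ) : MvPowerSeries ℕ ℂ := fun a =>
  if (∀ k, a k ≤ 1) ∧ ((a.degree : ℕ) : ℤ) = d then 1 else 0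

/-- The matrix `(e_{λ_i - μ_j - i + j})` of size `n`; for `n = ℓ(λ)` this is the (dual)
Jacobi-Trudi matrix of `λ/μ`. -/
noncomputable def jacobiTrudi (n : ℕ) (l μ : YoungDiagram) :
    Matrix (Fin n) (Fin n) (MvPowerSeries ℕ ℂ) :=
  Matrix.of fun i j =>
    elemSymm ((l.rowLen i : ℤ) - (μ.rowLen j : ℤ) - ((i : ℕ) : ℤ) + ((j : ℕ) : ℤ))

/-- The skew Schur function `s_{λ/μ}`, the determinant of the matrix
`(e_{λ'_i - μ'_j - i + j})` of size `ℓ(λ')`. -/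
noncomputable def skewSchur (l μ : YoungDiagram) : MvPowerSeries ℕ ℂ :=
  (jacobiTrudi (l.transpose.colLen 0) l.transpose μ.transpose).det

/-- The partition `(1^m)`: a column of `m` cells. -/
def column (m : ℕ) : YoungDiagram where
  cells := Finset.range m ×ˢ {0}
  isLowerSet := by
    rintro ⟨a, b⟩ ⟨c, d⟩ ⟨h1, h2⟩ h
    simp only [Finset.coe_product, Set.mem_prod, Finset.mem_coe, Finset.mem_range,
      Finset.mem_singleton] at h ⊢
    simp only at h1 h2
    omega

/-- `(1^m)` has `m` rows, so that its Jacobi-Trudi matrix is the one of size `m`. -/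
theorem column_length (m : ℕ) : (column m).colLen 0 = m := by
  have h : ∀ i, i < (column m).colLen 0 ↔ i < m := fun i => by
    rw [← YoungDiagram.mem_iff_lt_colLen, ← YoungDiagram.mem_cells]
    simp [column]
  exact le_antisymm (not_lt.mp fun hlt => lt_irrefl m ((h m).mp hlt))
    (not_lt.mp fun hlt => lt_irrefl _ ((h _).mpr hlt))

/-- The cells of the skew shape `λ/μ`. -/
def skewCells (l μ : YoungDiagram) : Finset (ℕ × ℕ) := l.cells \ μ.cells

/-- Two cells share an edge. -/
def CellAdj (c d : ℕ × ℕ) : Prop :=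
  (c.1 = d.1 ∧ (c.2 + 1 = d.2 ∨ d.2 + 1 = c.2)) ∨ (c.2 = d.2 ∧ (c.1 + 1 = d.1 ∨ d.1 + 1 = c.1))

/-- `λ/μ` is a ribbon: a skew shape that is connected (any two cells are joined by a path of
cells that successively share an edge) and has no `2 × 2` block of cells. -/
structure IsRibbon (l μ : YoungDiagram) : Prop where
  le : μ ≤ l
  connected : ∀ c ∈ skewCells l μ, ∀ d ∈ skewCells l μ, Relation.ReflTransGen
    (fun a b => a ∈ skewCells l μ ∧ b ∈ skewCells l μ ∧ CellAdj a b) c d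
  no_block : ∀ i j, ¬ ((i, j) ∈ skewCells l μ ∧ (i + 1, j) ∈ skewCells l μ ∧
    (i, j + 1) ∈ skewCells l μ ∧ (i + 1, j + 1) ∈ skewCells l μ)

/-- The set of ribbons `λ/μ` of size `m` with `{i : λ_i > μ_i} = [ℓ(λ)]`
(rows are counted from `0` here). -/
def ribbons (m : ℕ) : Set (YoungDiagram × YoungDiagram) :=
  {R | IsRibbon R.1 R.2 ∧ (skewCells R.1 R.2).card = m ∧
    ∀ i, R.2.rowLen i < R.1.rowLen i ↔ i < R.1.colLen 0}

end TLImm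

/-! Count indices from `0`. The matrix `(e (j + 1 - i))` is Hessenberg: its subdiagonal is `e 0 =
1`, and everything below that vanishes. Hence a permutation with a nonzero contribution is built
letter by letter: either `k` is fixed, or a factor `s_k` splits off, and `θ` turns this factor into
`t_k - 1`. The term with `k` fixed and the term from `-1` together form the first-column expansion
of a determinant of shape `(e (s_{j+1} - s_i))`; the term from `t_k` joins `k` and `k + 1` into one
block. So the immanant is a sum over sets `T` of generators: the coefficient of `τ` in the ascending
product of the `t_i`, `i ∈ T`, times such a determinant, where `s` lists the block ends
(`partialImm_eq_sum`).

An ascending product creates no loop, so it is a single diagram (`diagramAction_tlWord`), and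
different `T` give different diagrams (`wordDiagram_injOn`). Thus the immanant is one determinant if
`τ` comes from some `T`, and `0` otherwise.

For a ribbon, consecutive nonempty columns overlap in exactly one row (`colLen_succ_of_isRibbon`).
After the empty columns on the left are removed, its Jacobi-Trudi matrix is again `(e (s_{j+1} -
s_i))`, with `s` the partial sums of the column sizes (`skewSchur_eq_ribbonDet`). For `m > 0`, sets
`T` and compositions of `m` correspond to each other, and every composition is the list of column
sizes of a ribbon without empty columns (`exists_mem_ribbons_of_ribbonDet`). -/

namespace TLImm

/-! ### Determinants of the form `(e (s_{j+1} - s_i))`. -/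

section Determinant

variable {A : Type*} [CommRing A]

/-- The value of the determinant of `(e (s_{j+1} - s_i))` for `s = (a, l)`. -/
def ribbonDet (e : ℤ → A) : ℕ → List ℕ → A
  | _, [] => 1
  | a, [b] => e ((b : ℤ) - a)
  | a, b :: c :: l => e ((b : ℤ) - a) * ribbonDet e b (c :: l) - ribbonDet e a (c :: l)

/-- The list `[s 1, …, s k]`. -/
def tailList : (ℕ → ℕ) → ℕ → List ℕ
  | _, 0 => []
  | s, k + 1 => s 1 :: tailList (fun i => s (i + 1)) k

/-- The sequence `s` without its entry `s 1`. -/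
def dropOne (s : ℕ → ℕ) : ℕ → ℕ
  | 0 => s 0
  | i + 1 => s (i + 2)

/-- Expansion along the first column, whose entries are `e (s 1 - s 0)`, `e 0 = 1` and then zeros
because `s` increases. The two minors have the same form, for `s` without `s 0` and for `s` without
`s 1`. -/
theorem det_eq_ribbonDet (e : ℤ → A) (h0 : e 0 = 1) (hneg : ∀ d, d < 0 → e d = 0) (k : ℕ)
    (s : ℕ → ℕ) (hs : ∀ i < k, s i < s (i + 1)) :
    (Matrix.of fun i j : Fin k => e ((s (j + 1) : ℤ) - s i)).det =
      ribbonDet e (s 0) (tailList s k) := by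
  induction k generalizing s with
  | zero => simp [tailList, ribbonDet]
  | succ k ih =>
    rcases k with _ | k
    · simp [tailList, ribbonDet]
    · rw [Matrix.det_succ_column_zero, Fin.sum_univ_succ, Fin.sum_univ_succ,
        Finset.sum_eq_zero (fun i _ => ?_)]
      · have e1 := ih (fun i => s (i + 1)) (fun i hi => hs (i + 1) (by omega))
        have e2 := ih (dropOne s) (fun i hi => by
          rcases i with _ | i
          · exact (hs 0 (by omega)).trans (hs 1 (by omega))
          · exact hs (i + 2) (by omega))
        have m1 : (Matrix.of fun i j : Fin (k + 2) => e ((s (j + 1) : ℤ) - s i)).submatrix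
            (Fin.succAbove 0) Fin.succ =
            Matrix.of fun i j : Fin (k + 1) => e ((s (j + 1 + 1) : ℤ) - s (i + 1)) := by
          ext i j; simp
        have m2 : (Matrix.of fun i j : Fin (k + 2) => e ((s (j + 1) : ℤ) - s i)).submatrix
            (Fin.succAbove (Fin.succ 0)) Fin.succ =
            Matrix.of fun i j : Fin (k + 1) => e ((dropOne s (j + 1) : ℤ) - dropOne s i) := by
          ext i j
          refine Fin.cases ?_ (fun i => ?_) i
          · simp [dropOne]
          · simp [dropOne]
        rw [m1, m2, e1, e2]
        simp [h0, tailList, ribbonDet, dropOne]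
        ring
      · have h1 : s 1 < s (i + 1 + 1) := by
          have : ∀ t, t < k → s 1 < s (t + 1 + 1) := by
            intro t ht
            induction t with
            | zero => exact hs 1 (by omega)
            | succ t iht => exact (iht (by omega)).trans (hs (t + 1 + 1) (by omega))
          exact this i i.2
        rw [show (Matrix.of fun i j : Fin (k + 2) => e ((s (j + 1) : ℤ) - s i)) i.succ.succ 0 = 0
          from hneg _ (by simp; omega)]
        simp

end Determinant

/-! ### Expansion of the immanant of a Hessenberg matrix. -/

section Hessenberg

variable {n : ℕ}

/-- `θ(w)`. -/
noncomputable def thetaPerm (w : Equiv.Perm (Fin n)) : TL n :=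
  theta n (MonoidAlgebra.single (MulOpposite.op w) 1)

theorem thetaPerm_one : thetaPerm (1 : Equiv.Perm (Fin n)) = 1 := by
  rw [thetaPerm, MulOpposite.op_one, ← MonoidAlgebra.one_def, map_one]

/-- Passing to the opposite group reverses products, so a right factor `s_i` becomes a left factor
in `TL n`. -/
theorem thetaPerm_mul_simpleSwap (w : Equiv.Perm (Fin n)) (i : Fin (n - 1)) :
    thetaPerm (w * simpleSwap n i) = (TL.t i - 1) * thetaPerm w := by
  rw [thetaPerm, MulOpposite.op_mul, ← mul_one (1 : ℂ), ← MonoidAlgebra.single_mul_single, map_mul,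
    theta_simpleSwap]
  rfl

open Classical in
/-- The permutations that fix the first `k` letters. -/
noncomputable def fixingPerms (n k : ℕ) : Finset (Equiv.Perm (Fin n)) :=
  Finset.univ.filter fun w => ∀ i : Fin n, (i : ℕ) < k → w i = i

theorem mem_fixingPerms {k : ℕ} {w : Equiv.Perm (Fin n)} :
    w ∈ fixingPerms n k ↔ ∀ i : Fin n, (i : ℕ) < k → w i = i := by
  simp [fixingPerms]

variable {A : Type*} [CommRing A]

/-- The contribution of `w` to the immanant of the matrix `(e (j + 1 - i))` whose row `k` has been
replaced by row `a` and whose rows above `k` have been deleted. -/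
def rowProd (e : ℤ → A) (k a : ℕ) (w : Equiv.Perm (Fin n)) : A :=
  ∏ i ∈ Finset.univ.filter (fun i : Fin n => k ≤ (i : ℕ)),
    e (((w i : ℕ) : ℤ) + 1 - if (i : ℕ) = k then (a : ℤ) else ((i : ℕ) : ℤ))

theorem filter_le_eq_insert (k : ℕ) (hk : k < n) :
    Finset.univ.filter (fun i : Fin n => k ≤ (i : ℕ)) =
      insert ⟨k, hk⟩ (Finset.univ.filter (fun i : Fin n => k + 1 ≤ (i : ℕ))) := by
  ext i
  simp [Fin.ext_iff]
  omega

theorem rowProd_eq_mul (e : ℤ → A) (k a : ℕ) (hk : k < n) (w : Equiv.Perm (Fin n)) :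
    rowProd e k a w =
      e (((w ⟨k, hk⟩ : ℕ) : ℤ) + 1 - a) * rowProd e (k + 1) (k + 1) w := by
  rw [rowProd, filter_le_eq_insert k hk, Finset.prod_insert (by simp)]
  congr 1
  · simp
  · refine Finset.prod_congr rfl fun i hi => ?_
    have : k + 1 ≤ (i : ℕ) := by simpa using hi
    congr 2
    split_ifs <;> omega

theorem rowProd_eq_zero (e : ℤ → A) (hneg : ∀ d, d < 0 → e d = 0) (k a : ℕ)
    (w : Equiv.Perm (Fin n)) (i : Fin n) (hi : k < (i : ℕ)) (hw : (w i : ℕ) + 1 < i) :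
    rowProd e k a w = 0 := by
  refine Finset.prod_eq_zero (i := i) (by simp; omega) (hneg _ ?_)
  rw [if_neg (by omega)]
  omega

/-- After the swap, row `k + 1` meets column `k` in the subdiagonal entry `e 0 = 1`, and the special
row `a` takes the column `w (k + 1)`. Deleting the entry `1` leaves row `a` in position `k + 1`. -/
theorem rowProd_mul_simpleSwap (e : ℤ → A) (h0 : e 0 = 1) (k a : ℕ) (hk : k < n - 1)
    (w : Equiv.Perm (Fin n)) (hw : w ∈ fixingPerms n (k + 1)) :
    rowProd e k a (w * simpleSwap n ⟨k, hk⟩) = rowProd e (k + 1) a w := by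
  have hk1 : k < n := by omega
  have hk2 : k + 1 < n := by omega
  have s1 : simpleSwap n ⟨k, hk⟩ ⟨k, hk1⟩ = ⟨k + 1, hk2⟩ := Equiv.swap_apply_left _ _
  have s2 : simpleSwap n ⟨k, hk⟩ ⟨k + 1, hk2⟩ = ⟨k, hk1⟩ := Equiv.swap_apply_right _ _
  have w1 : w ⟨k, hk1⟩ = ⟨k, hk1⟩ := mem_fixingPerms.1 hw _ (by simp)
  rw [rowProd_eq_mul e k a hk1, rowProd_eq_mul e (k + 1) _ hk2, rowProd_eq_mul e (k + 1) _ hk2]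
  simp only [Equiv.Perm.mul_apply, s1, s2, w1]
  have : rowProd e (k + 1 + 1) (k + 1 + 1) (w * simpleSwap n ⟨k, hk⟩) =
      rowProd e (k + 1 + 1) (k + 1 + 1) w := by
    refine Finset.prod_congr rfl fun i hi => ?_
    have hi : k + 1 + 1 ≤ (i : ℕ) := by simpa using hi
    rw [Equiv.Perm.mul_apply, show simpleSwap n ⟨k, hk⟩ i = i from
      Equiv.swap_apply_of_ne_of_ne (by simp [Fin.ext_iff]; omega) (by simp [Fin.ext_iff]; omega)]
  rw [this]
  push_cast
  rw [sub_self, h0, one_mul]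

variable [Algebra ℂ A]

/-- The immanant of the matrix `(e (j + 1 - i))` whose row `k` has been
replaced by row `a`, restricted to the permutations that fix the letters below `k`. -/
noncomputable def partialImm (e : ℤ → A) (φ : TL n →ₗ[ℂ] ℂ) (k a : ℕ) : A :=
  ∑ w ∈ fixingPerms n k, φ (thetaPerm w) • rowProd e k a w

/-- The first term collects the permutations that fix `k`. The others that matter are `w * s_k` with
`w` fixing all letters up to `k`, and the factor `t_k - 1` splits them into the last two terms. The
factor `t_k` is absorbed into the functional, which is why `φ` is arbitrary. -/
theorem partialImm_succ (e : ℤ → A) (h0 : e 0 = 1) (hneg : ∀ d, d < 0 → e d = 0)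
    (φ : TL n →ₗ[ℂ] ℂ) (k a : ℕ) (hk : k < n - 1) :
    partialImm e φ k a = e ((k : ℤ) + 1 - a) * partialImm e φ (k + 1) (k + 1) -
      partialImm e φ (k + 1) a +
      partialImm e (φ.comp (LinearMap.mulLeft ℂ (TL.t ⟨k, hk⟩))) (k + 1) a := by
  have hk1 : k < n := by omega
  have hk2 : k + 1 < n := by omega
  have s1 : simpleSwap n ⟨k, hk⟩ ⟨k, hk1⟩ = ⟨k + 1, hk2⟩ := Equiv.swap_apply_left _ _
  have s3 : ∀ i : Fin n, (i : ℕ) < k → simpleSwap n ⟨k, hk⟩ i = i := fun i hi =>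
    Equiv.swap_apply_of_ne_of_ne (by simp [Fin.ext_iff]; omega) (by simp [Fin.ext_iff]; omega)
  have h1 : ∑ w ∈ (fixingPerms n k).filter (fun w => w ⟨k, hk1⟩ = ⟨k, hk1⟩),
      φ (thetaPerm w) • rowProd e k a w =
      e ((k : ℤ) + 1 - a) * partialImm e φ (k + 1) (k + 1) := by
    rw [partialImm, Finset.mul_sum]
    refine Finset.sum_congr ?_ fun w hw => ?_
    · ext w
      rw [Finset.mem_filter, mem_fixingPerms, mem_fixingPerms]
      constructor
      · rintro ⟨h, h'⟩ i hi
        rcases Nat.lt_succ_iff_lt_or_eq.1 hi with hi | hi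
        · exact h i hi
        · obtain rfl : i = ⟨k, hk1⟩ := Fin.ext hi
          exact h'
      · exact fun h => ⟨fun i hi => h i (by omega), h _ (by simp)⟩
    · rw [rowProd_eq_mul e k a hk1, mem_fixingPerms.1 hw ⟨k, hk1⟩ (by simp), mul_smul_comm]
  have h2 : ∑ w ∈ (fixingPerms n k).filter (fun w => ¬ w ⟨k, hk1⟩ = ⟨k, hk1⟩),
      φ (thetaPerm w) • rowProd e k a w =
      ∑ w ∈ fixingPerms n (k + 1), φ (thetaPerm (w * simpleSwap n ⟨k, hk⟩)) •
        rowProd e k a (w * simpleSwap n ⟨k, hk⟩) := by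
    symm
    refine Finset.sum_of_injOn (fun w => w * simpleSwap n ⟨k, hk⟩)
      (fun x _ y _ h => mul_right_cancel h) ?_ ?_ (fun _ _ => rfl)
    · intro w hw
      have hw' := mem_fixingPerms.1 hw
      simp only [Finset.coe_filter, Set.mem_ofPred_eq, mem_fixingPerms, Equiv.Perm.mul_apply, s1]
      refine ⟨fun i hi => by rw [s3 i hi, hw' i (by omega)], fun h => ?_⟩
      have := w.injective (h.trans (hw' ⟨k, hk1⟩ (by simp)).symm)
      simp [Fin.ext_iff] at this
    -- Column `k` is used by a row `i > k`. If `i > k + 1`, the entry lies below the subdiagonal and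
    -- vanishes; if `i = k + 1`, then `w * s_k` fixes `k`, so `w` is in the image after all.
    · intro w hw hw'
      rw [Finset.mem_filter, mem_fixingPerms] at hw
      obtain ⟨i, hi⟩ := w.surjective ⟨k, hk1⟩
      have hik : k < (i : ℕ) := by
        rcases lt_trichotomy (i : ℕ) k with h | h | h
        · rw [hw.1 i h] at hi
          simp [hi] at h
        · exact absurd (by rw [show (⟨k, hk1⟩ : Fin n) = i from Fin.ext h.symm]; rw [hi]; exact Fin.ext h.symm) hw.2
        · exact h
      rw [rowProd_eq_zero e hneg k a w i hik, smul_zero]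
      rw [hi]
      by_contra hcon
      obtain rfl : i = ⟨k + 1, hk2⟩ := Fin.ext (by simp at hcon ⊢; omega)
      refine hw' ⟨w * simpleSwap n ⟨k, hk⟩, ?_, ?_⟩
      · rw [Finset.mem_coe, mem_fixingPerms]
        intro j hj
        rw [Equiv.Perm.mul_apply]
        rcases Nat.lt_succ_iff_lt_or_eq.1 hj with hj | hj
        · rw [s3 j hj, hw.1 j hj]
        · obtain rfl : j = ⟨k, hk1⟩ := Fin.ext hj
          rw [s1, hi]
      · simp only [mul_assoc, simpleSwap_sq, mul_one]
  rw [partialImm, ← Finset.sum_filter_add_sum_filter_not _ (fun w => w ⟨k, hk1⟩ = ⟨k, hk1⟩), h1, h2]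
  suffices H : ∑ w ∈ fixingPerms n (k + 1), φ (thetaPerm (w * simpleSwap n ⟨k, hk⟩)) •
        rowProd e k a (w * simpleSwap n ⟨k, hk⟩) =
      partialImm e (φ.comp (LinearMap.mulLeft ℂ (TL.t ⟨k, hk⟩))) (k + 1) a -
        partialImm e φ (k + 1) a by
    rw [H]
    ring
  rw [partialImm, partialImm, ← Finset.sum_sub_distrib]
  refine Finset.sum_congr rfl fun w hw => ?_
  rw [rowProd_mul_simpleSwap e h0 k a hk w hw, thetaPerm_mul_simpleSwap, sub_mul, one_mul, map_sub,
    LinearMap.comp_apply, LinearMap.mulLeft_apply, sub_smul]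

/-- The ascending product of the generators `t_i` with `i ∈ T` and `k ≤ i < k + r`. -/
noncomputable def tlWord (n : ℕ) (T : Finset ℕ) : ℕ → ℕ → TL n
  | _, 0 => 1
  | k, r + 1 => if h : k ∈ T ∧ k < n - 1 then TL.t ⟨k, h.2⟩ * tlWord n T (k + 1) r
      else tlWord n T (k + 1) r

/-- The ends of the blocks of `{k, …, k + r}` in which `i` and `i + 1` are joined for `i ∈ T`. -/
def blockEnds (T : Finset ℕ) : ℕ → ℕ → List ℕ
  | k, 0 => [k + 1]
  | k, r + 1 => if k ∈ T then blockEnds T (k + 1) r else (k + 1) :: blockEnds T (k + 1) r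

theorem tlWord_insert (T : Finset ℕ) (j k r : ℕ) (hj : j < k) :
    tlWord n (insert j T) k r = tlWord n T k r := by
  induction r generalizing k with
  | zero => rfl
  | succ r ih =>
    have : k ≠ j := by omega
    simp [tlWord, ih (k + 1) (by omega), this]

theorem blockEnds_insert (T : Finset ℕ) (j k r : ℕ) (hj : j < k) :
    blockEnds (insert j T) k r = blockEnds T k r := by
  induction r generalizing k with
  | zero => rfl
  | succ r ih =>
    have : k ≠ j := by omega
    simp [blockEnds, ih (k + 1) (by omega), this]

/-- Makes the clause `b :: c :: l` of `ribbonDet` applicable when a block end is put in front. -/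
theorem blockEnds_eq_cons (T : Finset ℕ) (k r : ℕ) : ∃ c l, blockEnds T k r = c :: l := by
  induction r generalizing k with
  | zero => exact ⟨_, _, rfl⟩
  | succ r ih =>
    rw [blockEnds]
    split_ifs
    · exact ih _
    · exact ⟨_, _, rfl⟩

/-- Iterates `partialImm_succ`: the start `a` of the current block is carried along until the block
closes at `k + 1`. -/
theorem partialImm_eq_sum (e : ℤ → A) (h0 : e 0 = 1) (hneg : ∀ d, d < 0 → e d = 0) (r : ℕ)
    (φ : TL n →ₗ[ℂ] ℂ) (k a : ℕ) (hn : n = k + r + 1) :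
    partialImm e φ k a = ∑ T ∈ (Finset.Ico k (k + r)).powerset,
      φ (tlWord n T k r) • ribbonDet e a (blockEnds T k r) := by
  induction r generalizing k a φ with
  | zero =>
    -- Here `n = k + 1`, so only one letter is left.
    have hf : fixingPerms n k = {1} := by
      ext w
      rw [mem_fixingPerms, Finset.mem_singleton]
      constructor
      · intro h
        have h' : ∀ i : Fin n, (w i : ℕ) ≤ i := by
          intro i
          rcases Nat.lt_or_ge i k with hi | hi
          · rw [h i hi]
          · omega
        ext i
        rcases Nat.lt_or_ge i k with hi | hi
        · rw [h i hi]; rfl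
        · refine le_antisymm (h' i) ?_
          by_contra hlt
          have := w.injective (h (w i) (by omega))
          rw [this] at hlt
          exact hlt le_rfl
      · rintro rfl i _
        rfl
    rw [partialImm, hf, Finset.sum_singleton, thetaPerm_one, rowProd_eq_mul e k a (by omega)]
    have : rowProd e (k + 1) (k + 1) (1 : Equiv.Perm (Fin n)) = 1 :=
      Finset.prod_eq_one fun i hi => by
        have := (Finset.mem_filter.1 hi).2
        omega
    simp [this, tlWord, blockEnds, ribbonDet]
  | succ r ih =>
    have hk : k < n - 1 := by omega
    rw [partialImm_succ e h0 hneg φ k a hk, ih _ (k + 1) _ (by omega), ih _ (k + 1) _ (by omega),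
      ih _ (k + 1) _ (by omega), show Finset.Ico k (k + (r + 1)) =
        insert k (Finset.Ico (k + 1) (k + 1 + r)) by ext i; simp; omega,
      Finset.sum_powerset_insert (by simp)]
    congr 1
    -- Sets without `k`: a block ends at `k + 1`, and the two terms are the recursion of
    -- `ribbonDet`.
    · rw [Finset.mul_sum, ← Finset.sum_sub_distrib]
      refine Finset.sum_congr rfl fun T hT => ?_
      have hkT : k ∉ T := fun h => by simpa using Finset.mem_powerset.1 hT h
      obtain ⟨c, l, hcl⟩ := blockEnds_eq_cons T (k + 1) r
      simp only [tlWord, blockEnds, hkT, if_false, false_and, dif_neg, not_false_eq_true]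
      rw [hcl, ribbonDet, smul_sub, mul_smul_comm]
      push_cast
      rfl
    -- Sets containing `k`: the block goes on, with the same start `a`.
    · refine Finset.sum_congr rfl fun T _ => ?_
      simp only [tlWord, blockEnds, Finset.mem_insert_self, true_and, hk, dif_pos, if_true]
      rw [tlWord_insert T k _ _ (by omega), blockEnds_insert T k _ _ (by omega)]
      rfl

end Hessenberg

/-! ### Diagrams of ascending products of generators. -/

section WordDiagram

variable {n : ℕ}

open KauffmanDiagram

/-- The diagram of `tlWord n T k r`. -/
def wordDiagram (n : ℕ) (T : Finset ℕ) : ℕ → ℕ → KauffmanDiagram n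
  | _, 0 => one n
  | k, r + 1 => if h : k ∈ T ∧ k < n - 1 then cup ⟨k, h.2⟩ (wordDiagram n T (k + 1) r)
      else wordDiagram n T (k + 1) r

/-- The generators used so far have index at least `k` and do not touch the first `k` strands. -/
theorem wordDiagram_partner_of_lt (T : Finset ℕ) (k r : ℕ) (hn : n = k + r + 1) (x : Fin (2 * n))
    (hx : (x : ℕ) < k) : (wordDiagram n T k r).partner x = x.rev := by
  induction r generalizing k x with
  | zero => rfl
  | succ r ih =>
    have ih' := ih (k + 1) (by omega) x (by omega)
    rw [wordDiagram]
    split_ifs with h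
    · have hA : (wordDiagram n T (k + 1) r).partner (ptA ⟨k, h.2⟩) = (ptA ⟨k, h.2⟩).rev :=
        ih (k + 1) (by omega) _ (by simp [ptA])
      have hinv := (wordDiagram n T (k + 1) r).partner_partner (ptA' ⟨k, h.2⟩)
      rw [cup_apply, if_neg, if_neg, if_neg, if_neg, ih']
      · intro hx'
        rw [← hx', ih'] at hinv
        have := congrArg Fin.val hinv
        simp [Fin.val_rev, ptA'] at this
        omega
      · rw [hA]
        intro hx'
        have := congrArg Fin.val hx'
        simp [Fin.val_rev, ptA] at this
        omega
      · simp [Fin.ext_iff, ptA']; omega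
      · simp [Fin.ext_iff, ptA]; omega
    · exact ih'

/-- When `t_k` is attached, `A_{k+1}` is still joined to `B_{k+1}`, hence not to `A_{k+2}`: no loop
arises and every scalar is `1`. -/
theorem diagramAction_tlWord (T : Finset ℕ) (k r : ℕ) (hn : n = k + r + 1) :
    diagramAction n (tlWord n T k r) (Finsupp.single (one n) 1) =
      Finsupp.single (wordDiagram n T k r) 1 := by
  induction r generalizing k with
  | zero => simp [tlWord, wordDiagram]
  | succ r ih =>
    rw [tlWord, wordDiagram]
    split_ifs with h
    · rw [map_mul, Module.End.mul_apply, ih (k + 1) (by omega), diagramAction_t, genAct_single,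
        loopFactor, if_neg, one_mul]
      rw [wordDiagram_partner_of_lt T (k + 1) r (by omega) _ (by simp [ptA])]
      intro hx
      have := congrArg Fin.val hx
      simp [Fin.val_rev, ptA, ptA'] at this
      omega
    · exact ih (k + 1) (by omega)

/-- The boundary points `A_{j+1}` and `B_{j+1}` with `j ≤ i`. -/
def IsUpper (i : ℕ) (x : Fin (2 * n)) : Prop := (x : ℕ) ≤ i ∨ 2 * n ≤ x + i + 1

/-- Cut the rectangle between the heights of `A_{i+1}` and `A_{i+2}`. A generator `t_k` with `k ≠ i`
has its two left ends on the same side of the cut, so attaching it creates no edge across the cut.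
-/
theorem isUpper_wordDiagram (T : Finset ℕ) (i k r : ℕ) (hi : i ∉ T ∨ i < k) (hin : i + 1 < n)
    (x : Fin (2 * n)) (hx : IsUpper i x) : IsUpper i ((wordDiagram n T k r).partner x) := by
  induction r generalizing k x with
  | zero =>
    change IsUpper i x.rev
    simp only [IsUpper, Fin.val_rev] at hx ⊢
    omega
  | succ r ih =>
    have ih' := ih (k + 1) (hi.imp_right (by omega))
    rw [wordDiagram]
    split_ifs with h
    · have hki : k ≠ i := by
        rintro rfl
        exact hi.elim (fun h' => h' h.1) (lt_irrefl _)
      have hinv := (wordDiagram n T (k + 1) r).partner_partner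
      set d := wordDiagram n T (k + 1) r
      have hAA : IsUpper i (ptA (n := n) ⟨k, h.2⟩) ↔ IsUpper i (ptA' (n := n) ⟨k, h.2⟩) := by
        simp only [IsUpper, ptA, ptA']
        omega
      rw [cup_apply]
      split_ifs with h1 h2 h3 h4
      · exact hAA.1 (h1 ▸ hx)
      · exact hAA.2 (h2 ▸ hx)
      · refine ih' _ (hAA.1 ?_)
        rw [← hinv (ptA _), ← h3]
        exact ih' _ hx
      · refine ih' _ (hAA.2 ?_)
        rw [← hinv (ptA' _), ← h4]
        exact ih' _ hx
      · exact ih' _ hx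
    · exact ih' _ hx

/-- The point `x` is `B_{i+1}`. Attaching `t_i` joins it to the former partner of `A_{i+2}`, across
the cut. The generators attached afterwards have both left ends above the cut, so neither end is the
partner of `x` and the edge stays. -/
theorem not_isUpper_wordDiagram (T : Finset ℕ) (i k r : ℕ) (hn : n = k + r + 1) (hi : i ∈ T)
    (hki : k ≤ i) (hir : i < k + r) (x : Fin (2 * n)) (hx : (x : ℕ) + i + 1 = 2 * n) :
    ¬ IsUpper i ((wordDiagram n T k r).partner x) := by
  induction r generalizing k with
  | zero => omega
  | succ r ih =>
    have hinv := (wordDiagram n T (k + 1) r).partner_partner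
    have hkn : k < n - 1 := by omega
    have hxA : x ≠ ptA ⟨k, hkn⟩ := by simp [Fin.ext_iff, ptA]; omega
    have hxA' : x ≠ ptA' ⟨k, hkn⟩ := by simp [Fin.ext_iff, ptA']; omega
    rw [wordDiagram]
    rcases hki.eq_or_lt with rfl | hki
    · have hA : x = (wordDiagram n T (k + 1) r).partner (ptA ⟨k, hkn⟩) := by
        rw [wordDiagram_partner_of_lt T (k + 1) r (by omega) _ (by simp [ptA])]
        simp [Fin.ext_iff, Fin.val_rev, ptA]
        omega
      rw [dif_pos ⟨hi, hkn⟩, cup_apply, if_neg hxA, if_neg hxA', if_pos hA]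
      intro hU
      -- Only generators below the cut have been used before `t_k`, so an upper partner of `A_{k+2}`
      -- would force `A_{k+2}` itself to be upper.
      have := isUpper_wordDiagram T k (k + 1) r (Or.inr (by omega)) (by omega) _ hU
      rw [hinv] at this
      simp only [IsUpper, ptA'] at this
      omega
    · have ih' := ih (k + 1) (by omega) hki (by omega)
      split_ifs with h
      · rw [cup_apply, if_neg hxA, if_neg hxA', if_neg, if_neg]
        · exact ih'
        · intro hx'
          rw [hx', hinv] at ih'
          apply ih'
          simp only [IsUpper, ptA']
          omega
        · intro hx'
          rw [hx', hinv] at ih'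
          apply ih'
          simp only [IsUpper, ptA]
          omega
      · exact ih'

/-- The diagram determines `T`: `i ∈ T` exactly when the edge at `B_{i+1}` crosses the cut below
height `i`. -/
theorem wordDiagram_injOn (r : ℕ) :
    Set.InjOn (fun T => wordDiagram (r + 1) T 0 r) {T | T ⊆ Finset.range r} := by
  have key : ∀ T T' : Finset ℕ, T ⊆ Finset.range r →
      wordDiagram (r + 1) T 0 r = wordDiagram (r + 1) T' 0 r → T ⊆ T' := by
    intro T T' hT h i hi
    by_contra hi'
    have hir := Finset.mem_range.1 (hT hi)
    have h1 := not_isUpper_wordDiagram (n := r + 1) T i 0 r (by omega) hi (by omega) (by omega)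
      ⟨2 * (r + 1) - 1 - i, by omega⟩ (by simp; omega)
    rw [h] at h1
    exact h1 (isUpper_wordDiagram T' i 0 r (Or.inl hi') (by omega) _
      (Or.inr (by simp; omega)))
  exact fun T hT T' hT' h => (key T T' hT h).antisymm (key T' T hT' h.symm)

end WordDiagram

/-! ### The immanants of the Jacobi-Trudi matrix of a column. -/

section Immanant

theorem elemSymm_zero : elemSymm 0 = 1 := by
  classical
  ext a
  rw [MvPowerSeries.coeff_one]
  change (if _ then _ else _) = _
  congr 1
  rw [eq_iff_iff]
  constructor
  · rintro ⟨_, h⟩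
    exact (Finsupp.degree_eq_zero_iff a).1 (by exact_mod_cast h)
  · rintro rfl
    simp

theorem elemSymm_of_neg (d : ℤ) (hd : d < 0) : elemSymm d = 0 := by
  classical
  ext a
  change (if _ then _ else _) = _
  rw [if_neg]
  · simp
  · rintro ⟨_, h⟩
    omega

theorem column_rowLen (m i : ℕ) (hi : i < m) : (column m).rowLen i = 1 := by
  have h : ∀ j, j < (column m).rowLen i ↔ j < 1 := fun j => by
    rw [← YoungDiagram.mem_iff_lt_rowLen, ← YoungDiagram.mem_cells]
    simp [column, hi, eq_comm]
  have h0 := h 0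
  have h1 := h 1
  omega

theorem bot_rowLen (i : ℕ) : (⊥ : YoungDiagram).rowLen i = 0 := by
  by_contra h
  have := YoungDiagram.mem_iff_lt_rowLen.2 (Nat.pos_of_ne_zero h)
  exact YoungDiagram.notMem_bot _ this

/-- The coefficient of `τ`. -/
noncomputable def diagramCoeff {n : ℕ} (τ : KauffmanDiagram n) : TL n →ₗ[ℂ] ℂ :=
  ((Finsupp.lapply τ).comp
    (LinearMap.applyₗ (Finsupp.single (KauffmanDiagram.one n) (1 : ℂ)))).comp
      (diagramAction n).toLinearMap

/-- For `k = a = 0` no letter is fixed and row `0` is replaced by itself. -/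
theorem tlImmanant_column (r : ℕ) (τ : KauffmanDiagram (r + 1)) :
    tlImmanant τ (jacobiTrudi (r + 1) (column (r + 1)) ⊥) =
      partialImm elemSymm (diagramCoeff τ) 0 0 := by
  have : fixingPerms (r + 1) 0 = Finset.univ := by
    ext w
    simp [mem_fixingPerms]
  rw [partialImm, tlImmanant, immanant, this]
  refine Finset.sum_congr rfl fun w _ => ?_
  congr 1
  rw [rowProd, Finset.filter_true_of_mem (by simp)]
  refine Finset.prod_congr rfl fun i _ => ?_
  simp only [jacobiTrudi, Matrix.of_apply]
  rw [column_rowLen _ _ i.2, bot_rowLen]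
  congr 1
  split_ifs with h <;> simp [h] <;> ring

open Classical in
theorem tlImmanant_column_eq_sum (r : ℕ) (τ : KauffmanDiagram (r + 1)) :
    tlImmanant τ (jacobiTrudi (r + 1) (column (r + 1)) ⊥) =
      ∑ T ∈ (Finset.range r).powerset, if wordDiagram (r + 1) T 0 r = τ then
        ribbonDet elemSymm 0 (blockEnds T 0 r) else 0 := by
  rw [tlImmanant_column, partialImm_eq_sum elemSymm elemSymm_zero elemSymm_of_neg r _ 0 0 (by omega),
    zero_add, ← Finset.range_eq_Ico]
  refine Finset.sum_congr rfl fun T _ => ?_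
  have : diagramCoeff τ (tlWord (r + 1) T 0 r) =
      if wordDiagram (r + 1) T 0 r = τ then 1 else 0 := by
    change diagramAction (r + 1) (tlWord (r + 1) T 0 r) _ τ = _
    rw [diagramAction_tlWord T 0 r (by omega), Finsupp.single_apply]
  rw [this]
  split_ifs <;> simp

theorem tlImmanant_wordDiagram (r : ℕ) (T : Finset ℕ) (hT : T ⊆ Finset.range r) :
    tlImmanant (wordDiagram (r + 1) T 0 r) (jacobiTrudi (r + 1) (column (r + 1)) ⊥) =
      ribbonDet elemSymm 0 (blockEnds T 0 r) := by
  rw [tlImmanant_column_eq_sum, Finset.sum_eq_single T]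
  · rw [if_pos rfl]
  · intro T' hT' hne
    exact if_neg fun h => hne (wordDiagram_injOn r (Finset.mem_powerset.1 hT') hT h)
  · intro h
    exact absurd (Finset.mem_powerset.2 hT) h

theorem exists_wordDiagram_of_tlImmanant_ne_zero (r : ℕ) (τ : KauffmanDiagram (r + 1))
    (h : tlImmanant τ (jacobiTrudi (r + 1) (column (r + 1)) ⊥) ≠ 0) :
    ∃ T ⊆ Finset.range r, τ = wordDiagram (r + 1) T 0 r := by
  rw [tlImmanant_column_eq_sum] at h
  obtain ⟨T, hT, h⟩ := Finset.exists_ne_zero_of_sum_ne_zero h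
  refine ⟨T, Finset.mem_powerset.1 hT, ?_⟩
  by_contra hne
  exact h (if_neg fun h => hne h.symm)

theorem tlImmanant_of_isEmpty (τ : KauffmanDiagram 0)
    (M : Matrix (Fin 0) (Fin 0) (MvPowerSeries ℕ ℂ)) : tlImmanant τ M = 1 := by
  have h1 : tlFun τ 1 = 1 := by
    change diagramExpansion (thetaPerm 1) τ = 1
    rw [thetaPerm_one, diagramExpansion, map_one, Module.End.one_apply,
      show KauffmanDiagram.one 0 = τ from KauffmanDiagram.ext (Equiv.ext fun x => x.elim0),
      Finsupp.single_eq_same]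
  rw [tlImmanant, immanant, Fintype.sum_unique, show (default : Equiv.Perm (Fin 0)) = 1 from rfl, h1]
  simp

end Immanant

/-! ### Sets of generators and compositions. -/

section BlockEnds

theorem add_le_of_lt_succ {s : ℕ → ℕ} {k : ℕ} (hs : ∀ i < k, s i < s (i + 1)) (i j : ℕ)
    (hij : i ≤ j) (hj : j ≤ k) : s i + (j - i) ≤ s j := by
  induction j, hij using Nat.le_induction with
  | base => simp
  | succ j hij ih =>
    have := ih (by omega)
    have := hs j (by omega)
    omega

theorem tailList_congr (s t : ℕ → ℕ) (k : ℕ) (h : ∀ i ≤ k, s i = t i) :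
    tailList s k = tailList t k := by
  induction k generalizing s t with
  | zero => rfl
  | succ k ih =>
    rw [tailList, tailList, h 1 (by omega), ih _ _ fun i hi => h (i + 1) (by omega)]

/-- Read `K + 1` against `s 1`: if it is smaller, the block continues and `K` goes into `T`; if it
is equal, the block closes and `s` is shifted. -/
theorem exists_blockEnds_eq_tailList (r : ℕ) (K k : ℕ) (s : ℕ → ℕ)
    (hs : ∀ i < k, s i < s (i + 1)) (hk : 0 < k) (h1 : K < s 1) (hsk : s k = K + r + 1) :
    ∃ T ⊆ Finset.Ico K (K + r), blockEnds T K r = tailList s k := by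
  induction r generalizing K k s with
  | zero =>
    obtain rfl : k = 1 := by
      have := add_le_of_lt_succ hs 1 k hk le_rfl
      omega
    exact ⟨∅, by simp, by simp [blockEnds, tailList, hsk]⟩
  | succ r ih =>
    rcases Nat.lt_or_ge (K + 1) (s 1) with h | h
    · obtain ⟨T, hT, hT'⟩ := ih (K + 1) k s hs hk h (by omega)
      refine ⟨insert K T, ?_, ?_⟩
      · intro i hi
        rw [Finset.mem_insert] at hi
        rcases hi with rfl | hi
        · simp
        · have := Finset.mem_Ico.1 (hT hi)
          exact Finset.mem_Ico.2 (by omega)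
      · rw [blockEnds, if_pos (Finset.mem_insert_self _ _), blockEnds_insert _ _ _ _ (by omega), hT']
    · obtain ⟨k, rfl⟩ : ∃ k', k = k' + 1 := ⟨k - 1, by omega⟩
      have hk0 : 0 < k := by
        rcases Nat.eq_zero_or_pos k with rfl | hk0
        · rw [zero_add] at hsk; omega
        · exact hk0
      have h12 : s 1 < s (1 + 1) := hs 1 (by omega)
      obtain ⟨T, hT, hT'⟩ := ih (K + 1) k (fun i => s (i + 1)) (fun i hi => hs (i + 1) (by omega))
        hk0 (show K + 1 < s (1 + 1) by omega) (by omega)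
      refine ⟨T, fun i hi => ?_, ?_⟩
      · have := Finset.mem_Ico.1 (hT hi)
        exact Finset.mem_Ico.2 (by omega)
      · have hKT : K ∉ T := fun hi => by
          have := Finset.mem_Ico.1 (hT hi)
          omega
        rw [blockEnds, if_neg hKT, hT', tailList]
        congr 1
        omega

/-- The number `a` is the start of the current block. It survives while the block grows and is
replaced by `K + 1` in the recursion when the block closes. -/
theorem exists_tailList_eq_blockEnds (T : Finset ℕ) (r : ℕ) (K a : ℕ) (ha : a ≤ K) :
    ∃ (k : ℕ) (s : ℕ → ℕ), 0 < k ∧ (∀ i < k, s i < s (i + 1)) ∧ s 0 = a ∧ s k = K + r + 1 ∧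
      tailList s k = blockEnds T K r := by
  induction r generalizing K a with
  | zero =>
    refine ⟨1, fun i => if i = 0 then a else K + 1, one_pos, ?_, by simp, by simp,
      by simp [tailList, blockEnds]⟩
    intro i hi
    obtain rfl : i = 0 := by omega
    simp
    omega
  | succ r ih =>
    rw [blockEnds]
    split_ifs with h
    · obtain ⟨k, s, h1, h2, h3, h4, h5⟩ := ih (K + 1) a (by omega)
      exact ⟨k, s, h1, h2, h3, by omega, h5⟩
    · obtain ⟨k, s, h1, h2, h3, h4, h5⟩ := ih (K + 1) (K + 1) le_rfl
      refine ⟨k + 1, fun i => Nat.casesOn i a s, by omega, ?_, rfl, ?_, ?_⟩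
      · rintro (_ | i) hi
        · change a < s 0
          omega
        · exact h2 i (by omega)
      · change s k = _
        omega
      · rw [tailList, ← h5]
        change s 0 :: _ = _
        rw [h3]

end BlockEnds

/-! ### Jacobi-Trudi determinants of ribbons. -/

section JacobiTrudi

variable {A : Type*} [CommRing A]

/-- If `p 0 = q 0`, the first column is `e 0 = 1` on top of zeros: `p` is antitone, so the lower
entries have negative index. -/
theorem det_skip_empty (e : ℤ → A) (h0 : e 0 = 1) (hneg : ∀ d, d < 0 → e d = 0) (c k : ℕ)
    (p q : ℕ → ℕ) (hp : Antitone p) (hpq : ∀ i < c, p i = q i) :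
    (Matrix.of fun i j : Fin (k + c) =>
      e ((p i : ℤ) - (q j : ℤ) - ((i : ℕ) : ℤ) + ((j : ℕ) : ℤ))).det =
    (Matrix.of fun i j : Fin k =>
      e ((p (i + c) : ℤ) - (q (j + c) : ℤ) - ((i : ℕ) : ℤ) + ((j : ℕ) : ℤ))).det := by
  induction c generalizing p q with
  | zero => rfl
  | succ c ih =>
    have ih' := ih (fun i => p (i + 1)) (fun i => q (i + 1)) (fun i j h => hp (by omega))
      (fun i hi => hpq (i + 1) (by omega))
    refine Eq.trans ?_ (ih'.trans ?_)
    · refine (Matrix.det_succ_column_zero _).trans ?_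
      rw [Fin.sum_univ_succ, Finset.sum_eq_zero (fun i _ => ?_)]
      · simp only [Matrix.of_apply, Fin.val_zero, hpq 0 (by omega)]
        simp only [sub_self, Nat.cast_zero, add_zero, h0, pow_zero, one_mul]
        congr 1
        ext i j
        simp only [Matrix.submatrix_apply, Matrix.of_apply, Fin.succAbove_zero, Fin.val_succ]
        congr 1
        push_cast
        ring
      · have := hp (Nat.zero_le (i + 1))
        have := hpq 0 (by omega)
        rw [Matrix.of_apply, hneg _ (by simp; omega)]
        simp
    · congr 1

/-- With `s` the partial sums of `p j - q j`, the one-row overlap telescopes to `s i + p i = p 0 +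
i`. Hence `p i - q j - i + j = s (j + 1) - s i` for every entry. -/
theorem det_ribbon (e : ℤ → A) (h0 : e 0 = 1) (hneg : ∀ d, d < 0 → e d = 0) (k : ℕ)
    (p q : ℕ → ℕ) (hpq : ∀ i < k, q i < p i) (hp : ∀ i, i + 1 < k → p (i + 1) = q i + 1) :
    (Matrix.of fun i j : Fin k =>
      e ((p i : ℤ) - (q j : ℤ) - ((i : ℕ) : ℤ) + ((j : ℕ) : ℤ))).det =
    ribbonDet e 0 (tailList (fun i => ∑ j ∈ Finset.range i, (p j - q j)) k) := by
  have h1 : ∀ i < k, ∑ j ∈ Finset.range i, (p j - q j) + p i = p 0 + i := by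
    intro i hi
    induction i with
    | zero => simp
    | succ i ih =>
      have := ih (by omega)
      have := hpq i (by omega)
      have := hp i hi
      rw [Finset.sum_range_succ]
      omega
  have := det_eq_ribbonDet e h0 hneg k (fun i => ∑ j ∈ Finset.range i, (p j - q j))
    (fun i hi => by
      have := hpq i hi
      simp only [Finset.sum_range_succ]
      omega)
  rw [Finset.sum_range_zero] at this
  rw [← this]
  congr 1
  ext i j
  have hi := h1 i i.2
  have hj := h1 j j.2
  have := hpq j j.2
  simp only [Matrix.of_apply, Finset.sum_range_succ]
  congr 1
  omega

theorem skewSchur_eq_ribbonDet (l μ : YoungDiagram) (c k : ℕ) (hck : l.rowLen 0 = k + c)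
    (hc : ∀ i < c, l.colLen i = μ.colLen i) (hpq : ∀ i < k, μ.colLen (i + c) < l.colLen (i + c))
    (hp : ∀ i, i + 1 < k → l.colLen (i + 1 + c) = μ.colLen (i + c) + 1) :
    skewSchur l μ = ribbonDet elemSymm 0
      (tailList (fun i => ∑ j ∈ Finset.range i, (l.colLen (j + c) - μ.colLen (j + c))) k) := by
  have h := det_ribbon elemSymm elemSymm_zero elemSymm_of_neg k (fun i => l.colLen (i + c))
    (fun i => μ.colLen (i + c)) hpq hp
  rw [← h, ← det_skip_empty elemSymm elemSymm_zero elemSymm_of_neg c k l.colLen μ.colLen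
    (fun i j hij => l.colLen_anti i j hij) hc, skewSchur, YoungDiagram.colLen_transpose, hck]
  simp only [jacobiTrudi, YoungDiagram.rowLen_transpose]

end JacobiTrudi

/-! ### Ribbons and their column sizes. -/

section Ribbon

theorem mem_skewCells {l μ : YoungDiagram} {i j : ℕ} :
    (i, j) ∈ skewCells l μ ↔ μ.colLen j ≤ i ∧ i < l.colLen j := by
  rw [skewCells, Finset.mem_sdiff, YoungDiagram.mem_cells, YoungDiagram.mem_cells,
    YoungDiagram.mem_iff_lt_colLen, YoungDiagram.mem_iff_lt_colLen, not_lt, and_comm]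

theorem lt_rowLen_zero_iff {l : YoungDiagram} {j : ℕ} : j < l.rowLen 0 ↔ 0 < l.colLen j := by
  rw [← YoungDiagram.mem_iff_lt_rowLen, YoungDiagram.mem_iff_lt_colLen]

theorem card_skewCells (l μ : YoungDiagram) :
    (skewCells l μ).card = ∑ j ∈ Finset.range (l.rowLen 0), (l.colLen j - μ.colLen j) := by
  rw [Finset.card_eq_sum_card_fiberwise (f := Prod.snd) (t := Finset.range (l.rowLen 0))]
  · refine Finset.sum_congr rfl fun j _ => ?_
    have : (skewCells l μ).filter (fun x => x.2 = j) = (Finset.Ico (μ.colLen j) (l.colLen j)).map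
        ⟨fun i => (i, j), fun a b h => (Prod.ext_iff.1 h).1⟩ := by
      ext ⟨a, b⟩
      simp only [Finset.mem_filter, mem_skewCells, Finset.mem_map, Finset.mem_Ico]
      constructor
      · rintro ⟨h, rfl⟩
        exact ⟨a, h, rfl⟩
      · rintro ⟨a', h, h'⟩
        obtain ⟨rfl, rfl⟩ := Prod.ext_iff.1 h'
        exact ⟨h, rfl⟩
    rw [this, Finset.card_map, Nat.card_Ico]
  · rintro ⟨a, b⟩ h
    have := mem_skewCells.1 (Finset.mem_coe.1 h)
    exact Finset.mem_coe.2 (Finset.mem_range.2 (lt_rowLen_zero_iff.2 (by simp only; omega)))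

/-- A larger overlap of columns `j` and `j + 1` contains a `2 × 2` block; with no common row, column
`j` is cut off from the cells to its right. -/
theorem colLen_succ_of_isRibbon {l μ : YoungDiagram} (h : IsRibbon l μ)
    (hrow : ∀ i, μ.rowLen i < l.rowLen i ↔ i < l.colLen 0) (j : ℕ) (hj : j + 1 < l.rowLen 0)
    (hne : μ.colLen j < l.colLen j) : l.colLen (j + 1) = μ.colLen j + 1 := by
  have hl := l.colLen_anti j (j + 1) (by omega)
  have hμ := μ.colLen_anti j (j + 1) (by omega)
  refine le_antisymm ?_ ?_
  · by_contra hlt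
    refine h.no_block (μ.colLen j) j ?_
    simp only [mem_skewCells]
    omega
  · by_contra hlt
    have hl0 := l.colLen_anti 0 j (by omega)
    -- The row condition puts a cell in row `0`, so the last column, which lies to the right of
    -- column `j`, is not empty.
    have h0 : (0, l.rowLen 0 - 1) ∈ skewCells l μ := by
      have := (hrow 0).2 (by omega)
      rw [skewCells, Finset.mem_sdiff, YoungDiagram.mem_cells, YoungDiagram.mem_cells,
        YoungDiagram.mem_iff_lt_rowLen, YoungDiagram.mem_iff_lt_rowLen]
      omega
    have h1 : (μ.colLen j, j) ∈ skewCells l μ := mem_skewCells.2 ⟨le_rfl, hne⟩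
    have key : ∀ x, Relation.ReflTransGen
        (fun a b => a ∈ skewCells l μ ∧ b ∈ skewCells l μ ∧ CellAdj a b) (μ.colLen j, j) x →
        x.2 ≤ j := by
      intro x hx
      induction hx with
      | refl => exact le_rfl
      | @tail a b _ hab ih =>
        obtain ⟨a1, a2⟩ := a
        obtain ⟨b1, b2⟩ := b
        obtain ⟨ha, hb, hadj⟩ := hab
        simp only [CellAdj] at hadj ih ⊢
        by_contra hcon
        obtain rfl : a2 = j := by omega
        obtain rfl : b2 = a2 + 1 := by omega
        obtain rfl : a1 = b1 := by omega
        have := mem_skewCells.1 ha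
        have := mem_skewCells.1 hb
        omega
    have := key _ (h.connected _ h1 _ h0)
    simp only at this
    omega

/-- Empty columns can occur only on the left: from the first nonempty column `c` on, the one-row
overlap makes each next column nonempty. The sequence `s` consists of the partial sums of the column
sizes from `c` on. -/
theorem exists_ribbonDet_of_mem_ribbons {m : ℕ} (hm : 0 < m) {R : YoungDiagram × YoungDiagram}
    (hR : R ∈ ribbons m) :
    ∃ (k : ℕ) (s : ℕ → ℕ), 0 < k ∧ (∀ i < k, s i < s (i + 1)) ∧ s 0 = 0 ∧ s k = m ∧
      skewSchur R.1 R.2 = ribbonDet elemSymm 0 (tailList s k) := by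
  obtain ⟨l, μ⟩ := R
  obtain ⟨hrib, hcard, hrow⟩ := hR
  simp only at hrib hcard hrow ⊢
  rw [card_skewCells] at hcard
  have hle : ∀ j, μ.colLen j ≤ l.colLen j := by
    intro j
    by_contra h
    have := hrib.le (YoungDiagram.mem_iff_lt_colLen.2 (not_le.1 h))
    exact lt_irrefl _ (YoungDiagram.mem_iff_lt_colLen.1 this)
  have hex : ∃ j, μ.colLen j < l.colLen j := by
    by_contra! h
    rw [Finset.sum_eq_zero fun j _ => Nat.sub_eq_zero_of_le (h j)] at hcard
    omega
  classical
  set c := Nat.find hex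
  have hc : μ.colLen c < l.colLen c := Nat.find_spec hex
  have hc' : ∀ i < c, l.colLen i = μ.colLen i := fun i hi =>
    le_antisymm (not_lt.1 (Nat.find_min hex hi)) (hle i)
  have hcK : c < l.rowLen 0 := lt_rowLen_zero_iff.2 (by omega)
  obtain ⟨k, hk⟩ : ∃ k, l.rowLen 0 = k + c := ⟨l.rowLen 0 - c, by omega⟩
  have hne : ∀ i < k, μ.colLen (i + c) < l.colLen (i + c) := by
    intro i hi
    induction i with
    | zero => simpa using hc
    | succ i ih =>
      have h1 := colLen_succ_of_isRibbon hrib hrow (i + c) (by omega) (ih (by omega))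
      have h2 := μ.colLen_anti (i + c) (i + c + 1) (by omega)
      rw [show i + 1 + c = i + c + 1 by omega]
      omega
  refine ⟨k, _, by omega, ?_, ?_, ?_, skewSchur_eq_ribbonDet l μ c k hk hc' hne fun i hi => ?_⟩
  · intro i hi
    have := hne i hi
    simp only [Finset.sum_range_succ]
    omega
  · simp
  · rw [← hcard, hk, add_comm k c, Finset.sum_range_add,
      Finset.sum_eq_zero (s := Finset.range c), zero_add]
    · exact Finset.sum_congr rfl fun i _ => by rw [add_comm c i]
    · intro i hi
      rw [hc' i (Finset.mem_range.1 hi), Nat.sub_self]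
  · rw [show i + 1 + c = i + c + 1 by omega]
    exact colLen_succ_of_isRibbon hrib hrow (i + c) (by omega) (hne i (by omega))

/-- By the row condition a nonempty `l` would give a cell in row `0`; so `l` is empty and the
determinant has size `0`. -/
theorem skewSchur_of_mem_ribbons_zero {R : YoungDiagram × YoungDiagram} (hR : R ∈ ribbons 0) :
    skewSchur R.1 R.2 = 1 := by
  obtain ⟨l, μ⟩ := R
  obtain ⟨-, hcard, hrow⟩ := hR
  simp only at hcard hrow ⊢
  have h0 : l.rowLen 0 = 0 := by
    by_contra h
    have h1 := (hrow 0).2 (lt_rowLen_zero_iff.1 (Nat.pos_of_ne_zero h))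
    have h2 : (0, μ.rowLen 0) ∈ skewCells l μ := by
      rw [skewCells, Finset.mem_sdiff, YoungDiagram.mem_cells, YoungDiagram.mem_cells,
        YoungDiagram.mem_iff_lt_rowLen, YoungDiagram.mem_iff_lt_rowLen]
      omega
    rw [Finset.card_eq_zero.1 hcard] at h2
    simp at h2
  have := skewSchur_eq_ribbonDet l μ 0 0 h0 (by simp) (by simp) (by simp)
  simpa [tailList, ribbonDet] using this

/-- The Young diagram with the column lengths `f j`. -/
def ofColLens (f : ℕ → ℕ) (hf : Antitone f) (k : ℕ) : YoungDiagram where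
  cells := (Finset.range (f 0) ×ˢ Finset.range k).filter fun c => c.1 < f c.2
  isLowerSet := by
    rintro ⟨a, b⟩ ⟨c, d⟩ ⟨h1, h2⟩ h
    simp only [Finset.coe_filter, Finset.mem_product, Finset.mem_range, Set.mem_ofPred_eq] at h ⊢
    simp only at h1 h2
    have := hf h2
    omega

theorem colLen_ofColLens (f : ℕ → ℕ) (hf : Antitone f) (k : ℕ) (hk : ∀ j, k ≤ j → f j = 0)
    (j : ℕ) : (ofColLens f hf k).colLen j = f j := by
  have h : ∀ i, i < (ofColLens f hf k).colLen j ↔ i < f j := fun i => by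
    rw [← YoungDiagram.mem_iff_lt_colLen, ← YoungDiagram.mem_cells]
    simp only [ofColLens, Finset.mem_filter, Finset.mem_product, Finset.mem_range]
    have h1 := hf (Nat.zero_le j)
    have h2 := hk j
    omega
  have h1 := h (f j)
  have h2 := h ((ofColLens f hf k).colLen j)
  omega

/-- By `hlast` the last column reaches row `0`, so `(0, k - 1)` is a cell to which every other cell
can be connected. -/
theorem mem_ribbons_of_colLen (l μ : YoungDiagram) (k : ℕ) (hk : 0 < k)
    (hz : ∀ j, k ≤ j → l.colLen j = 0) (hpq : ∀ j < k, μ.colLen j < l.colLen j)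
    (hp : ∀ j, j + 1 < k → l.colLen (j + 1) = μ.colLen j + 1) (hlast : μ.colLen (k - 1) = 0) :
    (l, μ) ∈ ribbons (skewCells l μ).card ∧
      ∀ j, μ.colLen j < l.colLen j ↔ j < l.rowLen 0 := by
  have hlt : ∀ {i j}, (i, j) ∈ skewCells l μ → j < k := by
    intro i j h
    by_contra hj
    have := hz j (by omega)
    have := mem_skewCells.1 h
    omega
  -- Induction on the distance `d` to the upper right cell: move up inside a column, and to the
  -- right from its top cell, which is in the row shared with the next column.
  have hcon : ∀ d i j, (i, j) ∈ skewCells l μ → d = (k - 1 - j) + i → Relation.ReflTransGen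
      (fun a b => a ∈ skewCells l μ ∧ b ∈ skewCells l μ ∧ CellAdj a b) (i, j) (0, k - 1) := by
    intro d
    induction d with
    | zero =>
      intro i j h hd
      have := hlt h
      obtain rfl : i = 0 := by omega
      obtain rfl : j = k - 1 := by omega
      exact .refl
    | succ d ih =>
      intro i j h hd
      have hj := hlt h
      have h' := mem_skewCells.1 h
      rcases h'.1.eq_or_lt with hi | hi
      · have hjk : j + 1 < k := by
          by_contra hjk
          obtain rfl : j = k - 1 := by omega
          omega
        have := hp j hjk
        have := μ.colLen_anti j (j + 1) (by omega)
        have h2 : (i, j + 1) ∈ skewCells l μ := mem_skewCells.2 (by omega)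
        exact .head ⟨h, h2, by simp [CellAdj]⟩ (ih i (j + 1) h2 (by omega))
      · have h2 : (i - 1, j) ∈ skewCells l μ := mem_skewCells.2 (by omega)
        exact .head ⟨h, h2, by simp [CellAdj]; omega⟩ (ih (i - 1) j h2 (by omega))
  have hsymm : Std.Symm
      (fun a b => a ∈ skewCells l μ ∧ b ∈ skewCells l μ ∧ CellAdj a b) := by
    refine ⟨fun a b ⟨ha, hb, hab⟩ => ⟨hb, ha, ?_⟩⟩
    simp only [CellAdj] at hab ⊢
    omega
  refine ⟨⟨(⟨?_, ?_, ?_⟩ : IsRibbon l μ), rfl, ?_⟩, ?_⟩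
  · rw [← YoungDiagram.cells_subset_iff]
    rintro ⟨i, j⟩ h
    rw [YoungDiagram.mem_cells, YoungDiagram.mem_iff_lt_colLen] at h ⊢
    rcases Nat.lt_or_ge j k with hj | hj
    · exact h.trans (hpq j hj)
    · have := μ.colLen_anti (k - 1) j (by omega)
      omega
  · rintro ⟨a, b⟩ hab ⟨c, d⟩ hcd
    exact (hcon _ a b hab rfl).trans (Relation.ReflTransGen.stdSymm.symm _ _ (hcon _ c d hcd rfl))
  · rintro i j ⟨h1, -, -, h4⟩
    have := hp j (hlt h4)
    have := mem_skewCells.1 h1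
    have := mem_skewCells.1 h4
    omega
  · intro i
    simp only
    rw [← YoungDiagram.mem_iff_lt_colLen, YoungDiagram.mem_iff_lt_rowLen]
    refine ⟨fun h => by omega, fun h => ?_⟩
    -- The last cell of row `i` in `l` is not in `μ`, since the next column of `l` would otherwise
    -- reach row `i`.
    set j := l.rowLen i - 1 with hj
    have h1 : i < l.colLen j := by
      rw [← YoungDiagram.mem_iff_lt_colLen, YoungDiagram.mem_iff_lt_rowLen]
      omega
    have h2 : ¬ i < l.colLen (j + 1) := by
      rw [← YoungDiagram.mem_iff_lt_colLen, YoungDiagram.mem_iff_lt_rowLen]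
      omega
    have h3 : ¬ i < μ.colLen j := by
      rcases Nat.lt_or_ge (j + 1) k with hjk | hjk
      · have := hp j hjk
        omega
      · have := μ.colLen_anti (k - 1) j (by omega)
        omega
    rw [← YoungDiagram.mem_iff_lt_colLen, YoungDiagram.mem_iff_lt_rowLen] at h3
    omega
  · intro j
    rw [lt_rowLen_zero_iff]
    refine ⟨fun h => by omega, fun h => hpq j ?_⟩
    by_contra hj
    have := hz j (by omega)
    omega

theorem exists_mem_ribbons_of_ribbonDet (m k : ℕ) (s : ℕ → ℕ) (hk : 0 < k)
    (hs : ∀ i < k, s i < s (i + 1)) (hs0 : s 0 = 0) (hsk : s k = m) :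
    ∃ R ∈ ribbons m, (∀ j, R.2.colLen j < R.1.colLen j ↔ j < R.1.rowLen 0) ∧
      skewSchur R.1 R.2 = ribbonDet elemSymm 0 (tailList s k) := by
  have hle : ∀ j ≤ k, s j + (k - j) ≤ m := fun j hj =>
    hsk ▸ add_le_of_lt_succ hs j k hj le_rfl
  -- A ribbon with `m` cells in `k` columns has `m - (k - 1)` rows. The first `j` columns use `s j`
  -- cells, and `j` rows are shared between consecutive columns up to column `j`, which leaves `m -
  -- (k - 1) - (s j - j)` rows for column `j` of `l`.
  let p : ℕ → ℕ := fun j => if j < k then m - s j - (k - 1 - j) else 0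
  have hpz : ∀ j, k ≤ j → p j = 0 := fun j hj => if_neg (by omega)
  have hpk : ∀ j < k, p j + (k - 1 - j) + s j = m := by
    intro j hj
    have := hle j (by omega)
    simp only [p, if_pos hj]
    omega
  have hp : Antitone p := antitone_nat_of_succ_le fun j => by
    rcases Nat.lt_or_ge (j + 1) k with hj | hj
    · have := hpk j (by omega)
      have := hpk (j + 1) hj
      have := hs j (by omega)
      omega
    · rw [hpz _ hj]
      omega
  -- The one-row overlap forces these column lengths of `μ`. In the last column `p k = 0`, and
  -- truncated subtraction gives the required `0`.
  have hq : Antitone fun j => p (j + 1) - 1 := fun i j hij => by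
    have := hp (show i + 1 ≤ j + 1 by omega)
    simp only
    omega
  have hqk : ∀ j < k, p (j + 1) - 1 + (k - 1 - j) + s (j + 1) = m := by
    intro j hj
    rcases Nat.lt_or_ge (j + 1) k with hj' | hj'
    · have := hpk (j + 1) hj'
      have := hle (j + 1) hj
      omega
    · obtain rfl : k = j + 1 := by omega
      rw [hpz _ hj']
      omega
  have cl := colLen_ofColLens p hp k hpz
  have cμ := colLen_ofColLens _ hq k (fun j hj => by rw [hpz (j + 1) (by omega)])
  set l := ofColLens p hp k
  set μ := ofColLens _ hq k
  have f1 : ∀ j, k ≤ j → l.colLen j = 0 := fun j hj => by rw [cl, hpz j hj]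
  have f2 : ∀ j < k, l.colLen j - μ.colLen j = s (j + 1) - s j ∧ μ.colLen j < l.colLen j := by
    intro j hj
    rw [cl, cμ]
    have := hpk j hj
    have := hqk j hj
    have := hs j hj
    omega
  have f3 : ∀ j, j + 1 < k → l.colLen (j + 1) = μ.colLen j + 1 := by
    intro j hj
    rw [cl, cμ]
    have := hpk (j + 1) hj
    have := hle (j + 1) hj.le
    omega
  have f4 : μ.colLen (k - 1) = 0 := by
    rw [cμ, hpz _ (by omega)]
  have hrow : l.rowLen 0 = k := by
    have h1 : ∀ j, j < l.rowLen 0 ↔ j < k := fun j => by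
      rw [lt_rowLen_zero_iff]
      have := f1 j
      have := f2 j
      omega
    have := h1 k
    have := h1 (l.rowLen 0)
    omega
  have hsum : ∀ i ≤ k, ∑ j ∈ Finset.range i, (l.colLen j - μ.colLen j) = s i := by
    intro i hi
    induction i with
    | zero => simp [hs0]
    | succ i ih =>
      have := hs i hi
      rw [Finset.sum_range_succ, ih (by omega), (f2 i hi).1]
      omega
  obtain ⟨hR, hcol⟩ := mem_ribbons_of_colLen l μ k hk f1 (fun j hj => (f2 j hj).2) f3 f4
  rw [card_skewCells, hrow, hsum k le_rfl, hsk] at hR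
  refine ⟨(l, μ), hR, hcol, ?_⟩
  simp only
  rw [skewSchur_eq_ribbonDet l μ 0 k hrow (by simp) (fun j hj => (f2 j hj).2) f3]
  congr 1
  exact tailList_congr _ _ k hsum

end Ribbon

end TLImm

theorem mainTheorem7 (m : ℕ) :
    (∀ R ∈ TLImm.ribbons m, ∃ τ : TLImm.KauffmanDiagram m,
      TLImm.skewSchur R.1 R.2 =
        TLImm.tlImmanant τ (TLImm.jacobiTrudi m (TLImm.column m) ⊥)) ∧
    (∀ τ : TLImm.KauffmanDiagram m,
      TLImm.tlImmanant τ (TLImm.jacobiTrudi m (TLImm.column m) ⊥) ≠ 0 →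
        ∃ R ∈ TLImm.ribbons m,
          (∀ j, R.2.colLen j < R.1.colLen j ↔ j < R.1.rowLen 0) ∧
          TLImm.tlImmanant τ (TLImm.jacobiTrudi m (TLImm.column m) ⊥) =
            TLImm.skewSchur R.1 R.2) := by
  -- The case `m = 0` is separate because the expansion needs a last letter; there both sides are
  -- `1`.
  rcases m with _ | r
  · refine ⟨fun R hR => ⟨TLImm.KauffmanDiagram.one 0, ?_⟩, fun τ _ => ?_⟩
    · rw [TLImm.tlImmanant_of_isEmpty, TLImm.skewSchur_of_mem_ribbons_zero hR]
    · have hR : ((⊥, ⊥) : YoungDiagram × YoungDiagram) ∈ TLImm.ribbons 0 := by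
        refine ⟨⟨le_rfl, ?_, ?_⟩, ?_, fun i => ?_⟩
        · simp [TLImm.skewCells]
        · simp [TLImm.skewCells]
        · simp [TLImm.skewCells]
        · simp [TLImm.bot_rowLen, ← YoungDiagram.mem_iff_lt_colLen]
      refine ⟨_, hR, ?_, ?_⟩
      · simp [TLImm.bot_rowLen]
      · rw [TLImm.tlImmanant_of_isEmpty, TLImm.skewSchur_of_mem_ribbons_zero hR]
  · refine ⟨fun R hR => ?_, fun τ hτ => ?_⟩
    · obtain ⟨k, s, hk, hs, hs0, hsk, h⟩ :=
        TLImm.exists_ribbonDet_of_mem_ribbons (Nat.succ_pos r) hR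
      obtain ⟨T, hT, hT'⟩ := TLImm.exists_blockEnds_eq_tailList r 0 k s hs hk
        (by have := hs 0 hk; rw [zero_add] at this; omega) (by omega)
      rw [zero_add, ← Finset.range_eq_Ico] at hT
      refine ⟨TLImm.wordDiagram (r + 1) T 0 r, ?_⟩
      rw [TLImm.tlImmanant_wordDiagram r T hT, h, hT']
    · obtain ⟨T, hT, rfl⟩ := TLImm.exists_wordDiagram_of_tlImmanant_ne_zero r τ hτ
      obtain ⟨k, s, hk, hs, hs0, hsk, h⟩ := TLImm.exists_tailList_eq_blockEnds T r 0 0 le_rfl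
      obtain ⟨R, hR, hcol, hdet⟩ := TLImm.exists_mem_ribbons_of_ribbonDet (r + 1) k s hk hs hs0
        (by omega)
      exact ⟨R, hR, hcol, by rw [TLImm.tlImmanant_wordDiagram r T hT, hdet, h]⟩
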